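/- Let $\mathbb F$ be a non-archimedean local field of residue characteristic $p$, let $\mathcal G$ be a connected reductive linear algebraic group over $\mathbb F$ and $G=\mathcal G(\mathbb F)$ with its locally compact topology. Let $\mathcal P,\bar{\mathcal P}$ be opposite parabolic subgroups defined over $\mathbb F$, with unipotent radicals $\mathcal U,\bar{\mathcal U}$ and common Levi subgroup $\mathcal M=\mathcal P\cap\bar{\mathcal P}$; write $P, \bar P, U,\bar U,M$ for the groups of $\mathbb F$-rational points. Let $R$ be a unital ring in which $p$ is invertible and $V$ a smooth representation of $G$ on a left $R$-module. *Notation.* For a compact pro-$p$ subgroup $H\subseteq G$, $\langle H\rangle\colon V\to V$ is averaging over $H$ (normalised Haar measure), and $\langle KgK\rangle=\langle K\rangle g\langle K\rangle$. The roughening is $\mathrm{Rough}(V)=\varprojlim_L V^L$, where $L$ runs through the compact open pro-$p$ subgroups of $G$ and the map $V^{L'}\to V^{L}$ for $L'\subseteq L$ is $\langle L\rangle$; $G$ acts on it, and $V\subseteq \mathrm{Rough}(V)$. Let $i^{*P}_{G}(V)\subseteq\mathrm{Rough}(V)$ be the submodule of $M$-smooth, $U$-invariant vectors, and $r_G^{\bar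 P}(V)=V/\mathrm{span}\{\bar u v-v : \bar u\in\bar U, v\in V\}$. The group $M$ acts on both; both actions are twisted by the same character $\chi$ of $M$, where $\chi$ may be any homomorphism from $M$ to the central units of $R$ that is trivial on compact subgroups (the usual normalisation is $\chi=\delta_P^{-1/2}$). The natural map $\Phi\colon i^{*P}_{G}(V)\to r_G^{\bar P}(V)$ sends $x$ to the class of $\langle C\rangle x$, which lies in $V$, for any compact open pro-$p$ subgroup $C\subseteq\bar U$. A compact open subgroup $K\subseteq G$ is *well-placed* if it is pro-$p$ and the multiplication map $(K\cap U)\times(K\cap M)\times(K\cap\bar U)\to K$ is bijective, and likewise for every other ordering of the three factors. A central element $\lambda$ of $M$ is *strictly positive* (relative to $K$) if the subgroups $\lambda^n(K\cap U)\lambda^{-n}$, $n\in\mathbb N$, increase with union $U$, the subgroups $\lambda^{-n}(K\cap U)\lambda^{n}$ have intersection $\{1\}$, and the same holds with $(\lambda^{-1},\bar U)$ in place of $(\lambda,U)$. An endomorphism $T$ is *stable* if $\ker T=\ker T^2$ and $\operatorname{im}T=\operatorname{im}T^2$. *Proposition.* (1) Let $K$ be well-placed and $\lambda$ strictly positive relative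 to $K$. If $\langle K\lambda K\rangle^n\colon V\to V$ is stable for all sufficiently large $n$, then the natural map $\Phi$ is a well-defined, unique, $R$-linear, $M$-equivariant map, and it restricts to an isomorphism $i^{*P}_{G}(V)^{K\cap M}\cong r_G^{\bar P}(V)^{K\cap M}$. (2) Let $(K_e)_{e\in\mathbb N}$ be a sequence of well-placed subgroups such that every neighbourhood of $1$ in $G$ contains some $K_e$, and let $\lambda$ be strictly positive relative to every $K_e$. If for every $e$ the operator $\langle K_e\lambda K_e\rangle^n$ on $V$ is stable for all sufficiently large $n$, then the natural map $\Phi\colon i^{*P}_{G}(V)\to r_G^{\bar P}(V)$ (well-defined, unique, $R$-linear, $M$-equivariant) is bijective, that is, the Second Adjointness Theorem holds for $V$. -/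

import Mathlib

/-! ### Linear algebraic groups over a field, as closed subgroups of `GL n` over an algebraic closure -/

section AlgebraicGroups

/-- The value of a polynomial in the `n ^ 2` matrix entries at an invertible matrix. -/
noncomputable def evalGL {n : ℕ} {k : Type*} [Field k] (g : Matrix.GeneralLinearGroup (Fin n) k)
    (f : MvPolynomial (Fin n × Fin n) k) : k :=
  MvPolynomial.eval (fun ij => (g : Matrix (Fin n) (Fin n) k) ij.1 ij.2) f

/-- The Zariski topology on `GL n k`: its basic open sets are the non-vanishing loci of
polynomials in the matrix entries. -/
@[reducible]
def zariskiGL (n : ℕ) (k : Type*) [Field k] :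
    TopologicalSpace (Matrix.GeneralLinearGroup (Fin n) k) :=
  TopologicalSpace.generateFrom {s | ∃ f : MvPolynomial (Fin n × Fin n) k, s = {g | evalGL g f ≠ 0}}

/-- Zariski closed subgroups of `GL n k`. -/
def IsZariskiClosed {n : ℕ} {k : Type*} [Field k]
    (H : Subgroup (Matrix.GeneralLinearGroup (Fin n) k)) : Prop :=
  @IsClosed _ (zariskiGL n k) (H : Set (Matrix.GeneralLinearGroup (Fin n) k))

/-- Connectedness in the Zariski topology. -/
def IsZariskiConnected {n : ℕ} {k : Type*} [Field k]
    (H : Subgroup (Matrix.GeneralLinearGroup (Fin n) k)) : Prop :=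
  @IsConnected _ (zariskiGL n k) (H : Set (Matrix.GeneralLinearGroup (Fin n) k))

/-- Every element of the subgroup is a unipotent matrix. -/
def IsUnipotentSubgroup {n : ℕ} {k : Type*} [Field k]
    (H : Subgroup (Matrix.GeneralLinearGroup (Fin n) k)) : Prop :=
  ∀ g ∈ H, IsNilpotent ((g : Matrix (Fin n) (Fin n) k) - 1)

/-- `U` is the unipotent radical of `H`: the largest closed connected normal unipotent subgroup. -/
def IsUnipotentRadical {n : ℕ} {k : Type*} [Field k]
    (H U : Subgroup (Matrix.GeneralLinearGroup (Fin n) k)) : Prop :=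
  IsGreatest {N : Subgroup (Matrix.GeneralLinearGroup (Fin n) k) |
    N ≤ H ∧ (∀ h ∈ H, ∀ u ∈ N, h * u * h⁻¹ ∈ N) ∧ IsZariskiClosed N ∧ IsZariskiConnected N ∧
      IsUnipotentSubgroup N} U

/-- `B` is a Borel subgroup of `H`: a maximal closed connected solvable subgroup. -/
def IsBorelSubgroup {n : ℕ} {k : Type*} [Field k]
    (H B : Subgroup (Matrix.GeneralLinearGroup (Fin n) k)) : Prop :=
  Maximal (fun N : Subgroup (Matrix.GeneralLinearGroup (Fin n) k) =>
    N ≤ H ∧ IsZariskiClosed N ∧ IsZariskiConnected N ∧ Group.IsSolvable N) B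

/-- `P` is a parabolic subgroup of `H`: a closed subgroup that contains a Borel subgroup. -/
def IsParabolicSubgroup {n : ℕ} {k : Type*} [Field k]
    (H P : Subgroup (Matrix.GeneralLinearGroup (Fin n) k)) : Prop :=
  P ≤ H ∧ IsZariskiClosed P ∧ ∃ B, IsBorelSubgroup H B ∧ B ≤ P

/-- `L` is a Levi subgroup of `P`, where `U` is the unipotent radical of `P`: `P` is the semidirect
product of `L` and `U`. -/
def IsLeviSubgroup {n : ℕ} {k : Type*} [Field k]
    (P U L : Subgroup (Matrix.GeneralLinearGroup (Fin n) k)) : Prop :=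
  IsZariskiClosed L ∧ L ≤ P ∧ L ⊓ U = ⊥ ∧ ∀ x ∈ P, ∃ l ∈ L, ∃ u ∈ U, x = l * u

/-- `H` is defined over `F`: the ideal of all polynomials vanishing on `H` is generated by
polynomials with coefficients in `F`. -/
def IsDefinedOver (F : Type*) [Field F] {n : ℕ}
    (H : Subgroup (Matrix.GeneralLinearGroup (Fin n) (AlgebraicClosure F))) : Prop :=
  ∀ f : MvPolynomial (Fin n × Fin n) (AlgebraicClosure F), (∀ g ∈ H, evalGL g f = 0) →
    f ∈ Ideal.span {φ : MvPolynomial (Fin n × Fin n) (AlgebraicClosure F) |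
      (∀ g ∈ H, evalGL g φ = 0) ∧
        ∃ φ₀ : MvPolynomial (Fin n × Fin n) F,
          φ = MvPolynomial.map (algebraMap F (AlgebraicClosure F)) φ₀}

/-- A connected reductive linear algebraic group defined over `F`. -/
structure ReductiveGroup (F : Type*) [Field F] (n : ℕ) where
  /-- its points over the algebraic closure -/
  pts : Subgroup (Matrix.GeneralLinearGroup (Fin n) (AlgebraicClosure F))
  closed : IsZariskiClosed pts
  definedOver : IsDefinedOver F pts
  connected : IsZariskiConnected pts
  reductive : IsUnipotentRadical pts ⊥

/-- A pair of opposite parabolic subgroups defined over `F`: their intersection is a Levi subgroup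
of both of them. -/
structure OppositeParabolics {F : Type*} [Field F] {n : ℕ} (𝒢 : ReductiveGroup F n) where
  /-- the parabolic subgroup -/
  P : Subgroup (Matrix.GeneralLinearGroup (Fin n) (AlgebraicClosure F))
  /-- the opposite parabolic subgroup -/
  Pbar : Subgroup (Matrix.GeneralLinearGroup (Fin n) (AlgebraicClosure F))
  /-- the unipotent radical of `P` -/
  U : Subgroup (Matrix.GeneralLinearGroup (Fin n) (AlgebraicClosure F))
  /-- the unipotent radical of `Pbar` -/
  Ubar : Subgroup (Matrix.GeneralLinearGroup (Fin n) (AlgebraicClosure F))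
  parabolic : IsParabolicSubgroup 𝒢.pts P
  parabolic_bar : IsParabolicSubgroup 𝒢.pts Pbar
  definedOver : IsDefinedOver F P
  definedOver_bar : IsDefinedOver F Pbar
  radical : IsUnipotentRadical P U
  radical_bar : IsUnipotentRadical Pbar Ubar
  levi : IsLeviSubgroup P U (P ⊓ Pbar)
  levi_bar : IsLeviSubgroup Pbar Ubar (P ⊓ Pbar)

/-- The group of `F`-rational points. -/
noncomputable def rationalPoints (F : Type*) [Field F] {n : ℕ}
    (H : Subgroup (Matrix.GeneralLinearGroup (Fin n) (AlgebraicClosure F))) :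
    Subgroup (Matrix.GeneralLinearGroup (Fin n) F) :=
  H.comap (Matrix.GeneralLinearGroup.map (algebraMap F (AlgebraicClosure F)))

/-- The group `G` of `F`-rational points of a reductive group. For a topological field `F` it
carries the subspace topology of `GL n F`. -/
abbrev ReductiveGroup.G {F : Type*} [Field F] {n : ℕ} (𝒢 : ReductiveGroup F n) : Type _ :=
  ↥(rationalPoints F 𝒢.pts)

namespace OppositeParabolics

variable {F : Type*} [Field F] {n : ℕ} {𝒢 : ReductiveGroup F n} (D : OppositeParabolics 𝒢)

/-- The rational points of the unipotent radical of `P`. -/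
noncomputable def ptsU : Subgroup 𝒢.G := (rationalPoints F D.U).subgroupOf (rationalPoints F 𝒢.pts)

/-- The rational points of the unipotent radical of the opposite parabolic subgroup. -/
noncomputable def ptsUbar : Subgroup 𝒢.G := (rationalPoints F D.Ubar).subgroupOf (rationalPoints F 𝒢.pts)

/-- The rational points of the common Levi subgroup. -/
noncomputable def ptsM : Subgroup 𝒢.G := (rationalPoints F (D.P ⊓ D.Pbar)).subgroupOf (rationalPoints F 𝒢.pts)

theorem conj_mem_ptsU : ∀ m ∈ D.ptsM, ∀ u ∈ D.ptsU, m * u * m⁻¹ ∈ D.ptsU := by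
  intro m hm u hu
  have h := D.radical.1.2.1 _ (Subgroup.mem_inf.1 (Subgroup.mem_comap.1 (Subgroup.mem_subgroupOf.1 hm))).1 _
    (Subgroup.mem_comap.1 (Subgroup.mem_subgroupOf.1 hu))
  rw [← map_mul, ← map_inv, ← map_mul] at h
  exact Subgroup.mem_subgroupOf.2 (Subgroup.mem_comap.2 h)

theorem conj_mem_ptsUbar : ∀ m ∈ D.ptsM, ∀ u ∈ D.ptsUbar, m * u * m⁻¹ ∈ D.ptsUbar := by
  intro m hm u hu
  have h := D.radical_bar.1.2.1 _ (Subgroup.mem_inf.1 (Subgroup.mem_comap.1 (Subgroup.mem_subgroupOf.1 hm))).2 _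
    (Subgroup.mem_comap.1 (Subgroup.mem_subgroupOf.1 hu))
  rw [← map_mul, ← map_inv, ← map_mul] at h
  exact Subgroup.mem_subgroupOf.2 (Subgroup.mem_comap.2 h)

end OppositeParabolics

end AlgebraicGroups

/-! ### Smooth representations and averaging over compact pro-`p` subgroups -/

section Smooth

/-- A smooth representation of a topological group on a left `R`-module: every vector is fixed by
an open subgroup. -/
structure SmoothRep (R G V : Type*) [Ring R] [Group G] [TopologicalSpace G] [AddCommGroup V]
    [Module R V] where
  /-- the action -/
  act : G →* Module.End R V
  smooth : ∀ v : V, ∃ S : Subgroup G, IsOpen (S : Set G) ∧ ∀ g ∈ S, act g v = v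

/-- A compact subgroup all of whose open subgroups have index a power of `p`. In a totally
disconnected locally compact group these are the subgroups that are pro-`p` groups. -/
def IsCompactProP (p : ℕ) {G : Type*} [Group G] [TopologicalSpace G] (H : Subgroup G) : Prop :=
  IsCompact (H : Set G) ∧ ∀ S : Subgroup H, IsOpen (S : Set H) → ∃ k : ℕ, S.index = p ^ k

variable {R G V : Type*} [Ring R] [Group G] [TopologicalSpace G] [AddCommGroup V] [Module R V]

/-- The orbit of a vector under a subgroup. -/
def SmoothRep.orbit (σ : SmoothRep R G V) (H : Subgroup G) (v : V) : Set V :=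
  {w | ∃ h ∈ H, σ.act h v = w}

/-- The average of the (finite) orbit of `v` under a compact subgroup `H`; this is the integral of
`h ↦ h v` for the normalised Haar measure on `H`. -/
noncomputable def SmoothRep.avgFun (σ : SmoothRep R G V) (H : Subgroup G) (v : V) : V :=
  Ring.inverse ((Nat.card (σ.orbit H v) : ℕ) : R) • ∑ᶠ w ∈ σ.orbit H v, w

/-- The stabiliser of `v` in `H`. -/
def SmoothRep.fixer (σ : SmoothRep R G V) (H : Subgroup G) (v : V) : Subgroup H where
  carrier := {h | σ.act h v = v}
  one_mem' := by simp
  mul_mem' := by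
    intro a b ha hb
    simp only [Set.mem_ofPred_eq, Subgroup.coe_mul, map_mul, Module.End.mul_apply] at ha hb ⊢
    rw [hb, ha]
  inv_mem' := by
    intro a ha
    simp only [Set.mem_ofPred_eq] at ha ⊢
    conv_lhs => rw [← ha]
    rw [← Module.End.mul_apply, ← map_mul]
    simp

theorem SmoothRep.isOpen_fixer [IsTopologicalGroup G] (σ : SmoothRep R G V) (H : Subgroup G)
    (v : V) : IsOpen (σ.fixer H v : Set H) := by
  obtain ⟨S, hS, hv⟩ := σ.smooth v
  have h1 : IsOpen ((S.subgroupOf H : Subgroup H) : Set H) := hS.preimage continuous_subtype_val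
  refine Subgroup.isOpen_mono (H₁ := S.subgroupOf H) ?_ h1
  intro x hx
  exact hv _ hx

theorem isUnit_natCast_pow {p : ℕ} (hp : IsUnit (p : R)) (k : ℕ) :
    IsUnit ((p ^ k : ℕ) : R) := by
  rw [Nat.cast_pow]; exact hp.pow k

theorem inverse_natCast_mul_cancel {a b : ℕ} (ha : IsUnit (a : R)) (hb : IsUnit (b : R)) :
    Ring.inverse ((a * b : ℕ) : R) * (b : R) = Ring.inverse (a : R) := by
  have hab : IsUnit ((a * b : ℕ) : R) := by rw [Nat.cast_mul]; exact ha.mul hb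
  apply hab.mul_left_cancel
  rw [← mul_assoc, Ring.mul_inverse_cancel _ hab, one_mul, Nat.cast_mul,
    (Nat.cast_commute a (b : R)).eq, mul_assoc, Ring.mul_inverse_cancel _ ha, mul_one]

theorem SmoothRep.act_eq_of_quotient_eq (σ : SmoothRep R G V) {H : Subgroup G} {v : V}
    {T : Subgroup H} (hT : T ≤ σ.fixer H v) {a b : H} (h : (a : H ⧸ T) = b) :
    σ.act a v = σ.act b v := by
  have h1 : a⁻¹ * b ∈ T := QuotientGroup.eq.1 h
  have h2 : σ.act ((a⁻¹ * b : H) : G) v = v := hT h1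
  have h3 : (b : G) = a * ((a⁻¹ * b : H) : G) := by simp
  rw [h3, map_mul, Module.End.mul_apply, h2]

/-- The average may be computed over the cosets of any open subgroup fixing the vector. -/
theorem SmoothRep.avgFun_eq [IsTopologicalGroup G] {p : ℕ} [Fact p.Prime] (hp : IsUnit (p : R))
    (σ : SmoothRep R G V) {H : Subgroup G} (hH : IsCompactProP p H) (v : V) (T : Subgroup H)
    (hTo : IsOpen (T : Set H)) (hT : T ≤ σ.fixer H v) :
    σ.avgFun H v = Ring.inverse (T.index : R) • ∑ᶠ q : H ⧸ T, σ.act (q.out : H) v := by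
  classical
  set S := σ.fixer H v with hS
  obtain ⟨a, ha⟩ := hH.2 S (σ.isOpen_fixer H v)
  obtain ⟨b, hb⟩ := hH.2 T hTo
  have hp0 : p ≠ 0 := (Fact.out : p.Prime).ne_zero
  have hfS : S.FiniteIndex := ⟨by rw [ha]; exact pow_ne_zero _ hp0⟩
  have hfT : T.FiniteIndex := ⟨by rw [hb]; exact pow_ne_zero _ hp0⟩
  have : Fintype (H ⧸ S) := Fintype.ofFinite _
  have : Fintype (H ⧸ T) := Fintype.ofFinite _
  have hrel : T.relIndex S * S.index = T.index := Subgroup.relIndex_mul_index hT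
  obtain ⟨c, hc⟩ : ∃ c, T.relIndex S = p ^ c := by
    have : T.relIndex S ∣ p ^ b := by rw [← hb, ← hrel]; exact Dvd.intro _ rfl
    obtain ⟨c, -, hc⟩ := (Nat.dvd_prime_pow Fact.out).1 this
    exact ⟨c, hc⟩
  -- the orbit is the image of the cosets of the stabiliser
  have hinj : Function.Injective (fun q : H ⧸ S => σ.act (q.out : H) v) := by
    intro q r hqr
    have h1 : σ.act (((q.out)⁻¹ * r.out : H) : G) v = v := by
      simp only at hqr
      rw [Subgroup.coe_mul, map_mul, Module.End.mul_apply, ← hqr, ← Module.End.mul_apply, ← map_mul]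
      simp
    have h2 : (q.out)⁻¹ * r.out ∈ S := h1
    have h3 := QuotientGroup.eq.2 h2
    simpa using h3
  have hrange : Set.range (fun q : H ⧸ S => σ.act (q.out : H) v) = σ.orbit H v := by
    ext w
    constructor
    · rintro ⟨q, rfl⟩
      exact ⟨_, q.out.2, rfl⟩
    · rintro ⟨h, hh, rfl⟩
      refine ⟨((⟨h, hh⟩ : H) : H ⧸ S), ?_⟩
      exact σ.act_eq_of_quotient_eq (le_refl S) (b := ⟨h, hh⟩) (by simp)
  have hcard : Nat.card (σ.orbit H v) = S.index := by
    rw [← hrange]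
    exact (Nat.card_range_of_injective hinj)
  have hsum : ∑ᶠ w ∈ σ.orbit H v, w = ∑ q : H ⧸ S, σ.act (q.out : H) v := by
    rw [← hrange, finsum_mem_range hinj, finsum_eq_sum_of_fintype]
  have hT2 : ∑ q : H ⧸ T, σ.act (q.out : H) v
      = (T.relIndex S : R) • ∑ q : H ⧸ S, σ.act (q.out : H) v := by
    have : Fintype (S ⧸ T.subgroupOf S) := Fintype.ofFinite _
    have e := Subgroup.quotientEquivProdOfLE hT
    have h1 : ∀ q : H ⧸ T, σ.act (q.out : H) v
        = σ.act ((Subgroup.quotientMapOfLE hT q).out : H) v := by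
      intro q
      refine σ.act_eq_of_quotient_eq (le_refl S) ?_
      conv_lhs => rw [← Subgroup.quotientMapOfLE_apply_mk hT]
      simp
    have h2 : ∀ q : H ⧸ T, (Subgroup.quotientEquivProdOfLE hT q).1
        = Subgroup.quotientMapOfLE hT q := by
      intro q
      induction q using QuotientGroup.induction_on with
      | H z => rfl
    have h3 : ∑ q : H ⧸ T, σ.act (q.out : H) v
        = ∑ x : (H ⧸ S) × (S ⧸ T.subgroupOf S), σ.act (x.1.out : H) v := by
      refine Fintype.sum_equiv (Subgroup.quotientEquivProdOfLE hT) _ _ ?_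
      intro q
      rw [h1, h2]
    rw [h3, Fintype.sum_prod_type]
    simp only [Finset.sum_const, Finset.card_univ]
    rw [← Finset.smul_sum, ← Nat.cast_smul_eq_nsmul R, Subgroup.relIndex, Subgroup.index,
      Nat.card_eq_fintype_card]
  rw [SmoothRep.avgFun, hcard, hsum, finsum_eq_sum_of_fintype, hT2, smul_smul, ← hrel,
    mul_comm (T.relIndex S) S.index, inverse_natCast_mul_cancel]
  · rw [ha]; exact isUnit_natCast_pow hp a
  · rw [hc]; exact isUnit_natCast_pow hp c

/-- The projection `⟨H⟩` of `V` given by averaging over a compact pro-`p` subgroup `H`. -/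
noncomputable def SmoothRep.avg [IsTopologicalGroup G] {p : ℕ} [Fact p.Prime]
    (hp : IsUnit (p : R)) (σ : SmoothRep R G V) (H : Subgroup G) (hH : IsCompactProP p H) :
    V →ₗ[R] V where
  toFun := σ.avgFun H
  map_add' := by
    intro v w
    have ho := (σ.isOpen_fixer H v).inter (σ.isOpen_fixer H w)
    rw [← Subgroup.coe_inf] at ho
    obtain ⟨b, hb⟩ := hH.2 _ ho
    have hf : (σ.fixer H v ⊓ σ.fixer H w).FiniteIndex :=
      ⟨by rw [hb]; exact pow_ne_zero _ (Fact.out : p.Prime).ne_zero⟩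
    rw [σ.avgFun_eq hp hH v _ ho inf_le_left, σ.avgFun_eq hp hH w _ ho inf_le_right,
      σ.avgFun_eq hp hH (v + w) _ ho, ← smul_add, ← finsum_add_distrib (Set.toFinite _)
      (Set.toFinite _)]
    · simp
    · rintro x ⟨hx, hy⟩
      change σ.act x v = v at hx
      change σ.act x w = w at hy
      change σ.act x (v + w) = v + w
      rw [map_add, hx, hy]
  map_smul' := by
    intro r v
    have ho := σ.isOpen_fixer H v
    obtain ⟨b, hb⟩ := hH.2 _ ho
    have hf : (σ.fixer H v).FiniteIndex :=
      ⟨by rw [hb]; exact pow_ne_zero _ (Fact.out : p.Prime).ne_zero⟩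
    have : Fintype (H ⧸ σ.fixer H v) := Fintype.ofFinite _
    have hu : IsUnit ((σ.fixer H v).index : R) := by rw [hb]; exact isUnit_natCast_pow hp b
    rw [σ.avgFun_eq hp hH v _ ho le_rfl, σ.avgFun_eq hp hH (r • v) _ ho,
      finsum_eq_sum_of_fintype, finsum_eq_sum_of_fintype]
    · simp only [map_smul, ← Finset.smul_sum, RingHom.id_apply, smul_smul]
      congr 1
      apply hu.mul_left_cancel
      rw [← mul_assoc, Ring.mul_inverse_cancel _ hu, one_mul, ← mul_assoc,
        (Nat.cast_commute _ r).eq, mul_assoc, Ring.mul_inverse_cancel _ hu, mul_one]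
    · intro x hx
      change σ.act x v = v at hx
      change σ.act x (r • v) = r • v
      rw [map_smul, hx]

/-- The operator `⟨K g K⟩ = ⟨K⟩ g ⟨K⟩` on `V`. -/
noncomputable def SmoothRep.heckeOp [IsTopologicalGroup G] {p : ℕ} [Fact p.Prime]
    (hp : IsUnit (p : R)) (σ : SmoothRep R G V) (K : Subgroup G) (hK : IsCompactProP p K) (g : G) :
    Module.End R V :=
  σ.avg hp K hK * σ.act g * σ.avg hp K hK

/-- An endomorphism `T` is stable if `ker T = ker T²` and `im T = im T²`. -/
def IsStableEnd (T : Module.End R V) : Prop :=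
  LinearMap.ker T = LinearMap.ker (T ^ 2) ∧ LinearMap.range T = LinearMap.range (T ^ 2)

end Smooth

/-! ### The roughening -/

section Roughening

/-- Compact open pro-`p` subgroups of `G`. -/
@[ext]
structure OpenProP (p : ℕ) (G : Type*) [Group G] [TopologicalSpace G] where
  /-- the subgroup -/
  grp : Subgroup G
  isOpen : IsOpen (grp : Set G)
  isProP : IsCompactProP p grp

variable {R G V : Type*} [Ring R] [Group G] [TopologicalSpace G] [IsTopologicalGroup G]
  [AddCommGroup V] [Module R V] {p : ℕ}

theorem isOpen_map_conj {H : Subgroup G} (hH : IsOpen (H : Set G)) (g : G) :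
    IsOpen ((H.map (MulAut.conj g).toMonoidHom : Subgroup G) : Set G) := by
  have h1 : ((H.map (MulAut.conj g).toMonoidHom : Subgroup G) : Set G)
      = (fun x => g⁻¹ * x * g) ⁻¹' (H : Set G) := by
    ext x
    simp only [Subgroup.coe_map, Set.mem_image, SetLike.mem_coe, Set.mem_preimage]
    constructor
    · rintro ⟨y, hy, rfl⟩
      simpa [mul_assoc] using hy
    · intro hx
      exact ⟨_, hx, by simp [mul_assoc]⟩
  rw [h1]
  exact hH.preimage (by fun_prop)

theorem isCompactProP_map_conj {H : Subgroup G} (hH : IsCompactProP p H) (g : G) :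
    IsCompactProP p (H.map (MulAut.conj g).toMonoidHom) := by
  constructor
  · rw [Subgroup.coe_map]
    refine hH.1.image ?_
    change Continuous (fun x => g * x * g⁻¹)
    fun_prop
  · intro S hS
    let φ : H →* (H.map (MulAut.conj g).toMonoidHom : Subgroup G) :=
      (MulAut.conj g).toMonoidHom.subgroupMap H
    have hφ : Function.Surjective φ := (MulAut.conj g).toMonoidHom.subgroupMap_surjective H
    have hc : Continuous φ := by
      refine Continuous.subtype_mk (f := fun x : H => g * (x : G) * g⁻¹) ?_ _
      fun_prop
    obtain ⟨k, hk⟩ := hH.2 (S.comap φ) (hS.preimage hc)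
    exact ⟨k, by rw [← hk, Subgroup.index_comap_of_surjective S hφ]⟩

/-- The conjugate `g L g⁻¹`. -/
def OpenProP.conj (g : G) (L : OpenProP p G) : OpenProP p G where
  grp := L.grp.map (MulAut.conj g).toMonoidHom
  isOpen := isOpen_map_conj L.isOpen g
  isProP := isCompactProP_map_conj L.isProP g

theorem OpenProP.conj_one (L : OpenProP p G) : L.conj 1 = L := by
  ext x; simp [OpenProP.conj]

theorem OpenProP.conj_conj (g h : G) (L : OpenProP p G) :
    (L.conj h).conj g = L.conj (g * h) := by
  ext x; simp [OpenProP.conj, Subgroup.mem_map, mul_assoc]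

/-- The action of `G` on families of vectors indexed by the compact open pro-`p` subgroups,
`(g x)_L = g x_{g⁻¹ L g}`. -/
def SmoothRep.roughAct (σ : SmoothRep R G V) (p : ℕ) : G →* Module.End R (OpenProP p G → V) where
  toFun g :=
    { toFun := fun x L => σ.act g (x (L.conj g⁻¹))
      map_add' := by intro x y; funext L; simp
      map_smul' := by intro r x; funext L; simp }
  map_one' := by
    ext x L
    simp [OpenProP.conj_one]
  map_mul' := by
    intro g h
    refine LinearMap.ext fun x => funext fun L => ?_
    change σ.act (g * h) (x (L.conj (g * h)⁻¹)) = σ.act g (σ.act h (x ((L.conj g⁻¹).conj h⁻¹)))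
    rw [OpenProP.conj_conj, map_mul, mul_inv_rev, Module.End.mul_apply]

/-- The roughening of `V`: the projective limit of the spaces `V^L` over all compact open pro-`p`
subgroups `L`, where `V^{L'} → V^L` for `L' ≤ L` is averaging over `L`. -/
noncomputable def SmoothRep.rough [Fact p.Prime] (hp : IsUnit (p : R)) (σ : SmoothRep R G V) :
    Submodule R (OpenProP p G → V) where
  carrier := {x | (∀ L : OpenProP p G, ∀ g ∈ L.grp, σ.act g (x L) = x L) ∧
    ∀ L L' : OpenProP p G, L'.grp ≤ L.grp → σ.avg hp L.grp L.isProP (x L') = x L}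
  zero_mem' := by constructor <;> intros <;> simp
  add_mem' := by
    rintro x y ⟨hx, hx'⟩ ⟨hy, hy'⟩
    refine ⟨fun L g hg => ?_, fun L L' h => ?_⟩
    · simp [hx L g hg, hy L g hg]
    · simp [hx' L L' h, hy' L L' h]
  smul_mem' := by
    rintro r x ⟨hx, hx'⟩
    refine ⟨fun L g hg => ?_, fun L L' h => ?_⟩
    · simp [hx L g hg]
    · simp [hx' L L' h]

theorem SmoothRep.act_inv_act (σ : SmoothRep R G V) (g : G) (v : V) :
    σ.act g⁻¹ (σ.act g v) = v := by
  rw [← Module.End.mul_apply, ← map_mul]; simp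

theorem SmoothRep.act_avg [Fact p.Prime] (hp : IsUnit (p : R)) (σ : SmoothRep R G V) (g : G)
    (L : OpenProP p G) (v : V) :
    σ.act g (σ.avg hp L.grp L.isProP v)
      = σ.avg hp (L.conj g).grp (L.conj g).isProP (σ.act g v) := by
  change σ.act g (σ.avgFun L.grp v) = σ.avgFun (L.conj g).grp (σ.act g v)
  have hinj : Function.Injective (σ.act g) := fun a b h => by
    rw [← σ.act_inv_act g a, h, σ.act_inv_act]
  have ho : σ.orbit (L.conj g).grp (σ.act g v) = σ.act g '' σ.orbit L.grp v := by
    ext w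
    constructor
    · rintro ⟨_, ⟨h, hh, rfl⟩, rfl⟩
      refine ⟨_, ⟨h, hh, rfl⟩, ?_⟩
      simp only [← Module.End.mul_apply, ← map_mul]
      simp
    · rintro ⟨_, ⟨h, hh, rfl⟩, rfl⟩
      refine ⟨_, ⟨h, hh, rfl⟩, ?_⟩
      simp only [← Module.End.mul_apply, ← map_mul]
      simp
  obtain ⟨k, hk⟩ := L.isProP.2 _ (σ.isOpen_fixer L.grp v)
  have hfin : (σ.fixer L.grp v).FiniteIndex :=
    ⟨by rw [hk]; exact pow_ne_zero _ (Fact.out : p.Prime).ne_zero⟩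
  have hof : (σ.orbit L.grp v).Finite := by
    refine (Set.finite_range (fun q : L.grp ⧸ σ.fixer L.grp v =>
      σ.act (q.out : L.grp) v)).subset ?_
    rintro w ⟨h, hh, rfl⟩
    refine ⟨((⟨h, hh⟩ : L.grp) : L.grp ⧸ σ.fixer L.grp v), ?_⟩
    exact σ.act_eq_of_quotient_eq le_rfl (b := ⟨h, hh⟩) (by simp)
  rw [SmoothRep.avgFun, SmoothRep.avgFun, ho, map_smul, finsum_mem_image hinj.injOn,
    Nat.card_image_of_injective hinj]
  congr 1
  exact (σ.act g).toAddMonoidHom.map_finsum_mem (fun w => w) hof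

theorem SmoothRep.roughAct_mem_rough [Fact p.Prime] (hp : IsUnit (p : R)) (σ : SmoothRep R G V)
    (g : G) {x : OpenProP p G → V} (hx : x ∈ σ.rough hp) : σ.roughAct p g x ∈ σ.rough hp := by
  have hconj : ∀ L : OpenProP p G, (L.conj g⁻¹).conj g = L := fun L => by
    rw [OpenProP.conj_conj, mul_inv_cancel, OpenProP.conj_one]
  refine ⟨fun L h hh => ?_, fun L L' hL => ?_⟩
  · have h1 : g⁻¹ * h * g ∈ (L.conj g⁻¹).grp := ⟨h, hh, by simp⟩
    have h2 := hx.1 _ _ h1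
    change σ.act h (σ.act g _) = σ.act g _
    conv_rhs => rw [← h2]
    simp only [← Module.End.mul_apply, ← map_mul]
    simp [mul_assoc]
  · change σ.avg hp L.grp L.isProP (σ.act g _) = σ.act g _
    rw [← hx.2 (L.conj g⁻¹) (L'.conj g⁻¹) (Subgroup.map_mono hL), σ.act_avg]
    simp only [hconj]

end Roughening

/-! ### The right adjoint of parabolic induction, Jacquet restriction and the natural map -/

section Jacquet

variable {R G V : Type*} [Ring R] [Group G] [TopologicalSpace G] [IsTopologicalGroup G]
  [AddCommGroup V] [Module R V] {p : ℕ} [Fact p.Prime]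

/-- The space of `M`-smooth, `U`-invariant vectors in the roughening of `V`. -/
noncomputable def SmoothRep.iStar (hp : IsUnit (p : R)) (σ : SmoothRep R G V) (U M : Subgroup G) :
    Submodule R (OpenProP p G → V) where
  carrier := {x | x ∈ σ.rough hp ∧ (∀ u ∈ U, σ.roughAct p u x = x) ∧
    ∃ S : Subgroup M, IsOpen (S : Set M) ∧ ∀ m ∈ S, σ.roughAct p m x = x}
  zero_mem' := ⟨zero_mem _, fun _ _ => map_zero _, ⊤, isOpen_univ, fun _ _ => map_zero _⟩
  add_mem' := by
    rintro x y ⟨hx, hxU, S, hS, hxS⟩ ⟨hy, hyU, S', hS', hyS⟩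
    refine ⟨add_mem hx hy, fun u hu => ?_, S ⊓ S', hS.inter hS', fun m hm => ?_⟩
    · rw [map_add, hxU u hu, hyU u hu]
    · rw [map_add, hxS m hm.1, hyS m hm.2]
  smul_mem' := by
    rintro r x ⟨hx, hxU, S, hS, hxS⟩
    refine ⟨Submodule.smul_mem _ _ hx, fun u hu => ?_, S, hS, fun m hm => ?_⟩
    · rw [map_smul, hxU u hu]
    · rw [map_smul, hxS m hm]

theorem SmoothRep.roughAct_mem_iStar (hp : IsUnit (p : R)) (σ : SmoothRep R G V)
    {U M : Subgroup G} (hMU : ∀ m ∈ M, ∀ u ∈ U, m * u * m⁻¹ ∈ U) (m : M)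
    (x : OpenProP p G → V) (hx : x ∈ σ.iStar hp U M) :
    σ.roughAct p (m : G) x ∈ σ.iStar hp U M := by
  obtain ⟨h1, hU, S, hS, hxS⟩ := hx
  refine ⟨σ.roughAct_mem_rough hp _ h1, fun u hu => ?_,
    S.map (MulAut.conj m).toMonoidHom, isOpen_map_conj hS m, ?_⟩
  · have h2 := hU _ (hMU _ (inv_mem m.2) u hu)
    conv_rhs => rw [← h2]
    simp only [← Module.End.mul_apply, ← map_mul]
    simp [mul_assoc]
  · rintro _ ⟨s, hs, rfl⟩
    conv_rhs => rw [← hxS s hs]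
    simp only [← Module.End.mul_apply, ← map_mul]
    simp

/-- The (untwisted) action of `M` on `iStar`. -/
noncomputable def SmoothRep.iStarAct (hp : IsUnit (p : R)) (σ : SmoothRep R G V)
    {U M : Subgroup G} (hMU : ∀ m ∈ M, ∀ u ∈ U, m * u * m⁻¹ ∈ U) :
    M →* Module.End R (σ.iStar hp U M) where
  toFun m := (σ.roughAct p (m : G)).restrict (σ.roughAct_mem_iStar hp hMU m)
  map_one' := by ext x; simp
  map_mul' := by intro a b; ext x; simp

/-- The span of all `u v - v` with `u` in the subgroup `N`. -/
def SmoothRep.coinvKer (σ : SmoothRep R G V) (N : Subgroup G) : Submodule R V :=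
  Submodule.span R {w | ∃ u ∈ N, ∃ v : V, w = σ.act u v - v}

/-- The coinvariant space `V / V(N)`. -/
abbrev SmoothRep.jacquet (σ : SmoothRep R G V) (N : Subgroup G) : Type _ := V ⧸ σ.coinvKer N

/-- The (untwisted) action of `M` on the `N`-coinvariant space. -/
def SmoothRep.jacquetAct (σ : SmoothRep R G V) {N M : Subgroup G}
    (hMN : ∀ m ∈ M, ∀ u ∈ N, m * u * m⁻¹ ∈ N) : M →* Module.End R (σ.jacquet N) where
  toFun m := (σ.coinvKer N).mapQ (σ.coinvKer N) (σ.act (m : G)) (by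
    refine Submodule.span_le.2 ?_
    rintro _ ⟨u, hu, v, rfl⟩
    refine Submodule.subset_span ⟨_, hMN _ m.2 u hu, σ.act (m : G) v, ?_⟩
    rw [map_sub]
    simp only [← Module.End.mul_apply, ← map_mul]
    simp)
  map_one' := by ext x; simp
  map_mul' := by
    intro a b
    refine LinearMap.ext fun y => ?_
    obtain ⟨v, rfl⟩ := Submodule.Quotient.mk_surjective _ y
    simp only [Submodule.mapQ_apply, Module.End.mul_apply, Subgroup.coe_mul, map_mul]
    rfl

/-- The twist of an action by a character with values in the central units of `R`. -/
def twistAct {W M : Type*} [AddCommGroup W] [Module R W] [Group M]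
    (χ : M →* (Subring.center R)ˣ) (τ : M →* Module.End R W) : M →* Module.End R W where
  toFun m :=
    { toFun := fun w => ((χ m : Subring.center R) : R) • τ m w
      map_add' := by intro v w; simp
      map_smul' := by
        intro r w
        have h : ((χ m : Subring.center R) : R) * r = r * ((χ m : Subring.center R) : R) :=
          ((Subring.mem_center_iff.1 (χ m : Subring.center R).2) r).symm
        rw [map_smul, smul_smul, h, ← smul_smul, RingHom.id_apply] }
  map_one' := by ext w; simp
  map_mul' := by
    intro a b
    ext w
    simp only [map_mul, Units.val_mul, Subring.coe_mul, LinearMap.coe_mk, AddHom.coe_mk,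
      Module.End.mul_apply, map_smul, mul_smul]
    rw [smul_smul, smul_smul, ← Subring.mem_center_iff.1 (χ b : Subring.center R).2]

/-- The vectors fixed by a subgroup. -/
def fixedVectors {W M : Type*} [AddCommGroup W] [Module R W] [Group M] (τ : M →* Module.End R W)
    (S : Subgroup M) : Submodule R W where
  carrier := {w | ∀ m ∈ S, τ m w = w}
  zero_mem' := fun _ _ => map_zero _
  add_mem' := by intro v w hv hw m hm; rw [map_add, hv m hm, hw m hm]
  smul_mem' := by intro r w hw m hm; rw [map_smul, hw m hm]

/-- For an element `x` of the roughening, a compact pro-`p` subgroup `C` and `w ∈ V`: the average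
`⟨C⟩ x` is the image `(⟨L⟩ w)_L` of `w`. The component of `⟨C⟩ x` at a compact open pro-`p` subgroup
`L` that is normalised by `C` is `⟨L⟩ ⟨C⟩ x = ⟨C⟩ ⟨L⟩ x = ⟨C⟩ x_L`, and these `L` are cofinal. -/
def SmoothRep.IsAverage (hp : IsUnit (p : R)) (σ : SmoothRep R G V) (C : Subgroup G)
    (hC : IsCompactProP p C) (x : OpenProP p G → V) (w : V) : Prop :=
  ∀ L : OpenProP p G, (∀ c ∈ C, ∀ l ∈ L.grp, c * l * c⁻¹ ∈ L.grp) →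
    σ.avg hp C hC (x L) = σ.avg hp L.grp L.isProP w

/-- `Φ` is the natural map from the `M`-smooth, `U`-invariant vectors in the roughening of `V` to
the coinvariants of `V` for the opposite unipotent subgroup: it maps `x` to the class of
`⟨C⟩ x`, which belongs to `V`, for every compact open pro-`p` subgroup `C` of the opposite
unipotent subgroup. -/
def SmoothRep.IsNaturalMap (hp : IsUnit (p : R)) (σ : SmoothRep R G V) (U M Ubar : Subgroup G)
    (Φ : σ.iStar hp U M →ₗ[R] σ.jacquet Ubar) : Prop :=
  ∀ (x : σ.iStar hp U M) (C : Subgroup G) (hC : IsCompactProP p C), C ≤ Ubar →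
    IsOpen ((C.subgroupOf Ubar : Subgroup Ubar) : Set Ubar) →
      ∃ w : V, σ.IsAverage hp C hC x w ∧ Φ x = (σ.coinvKer Ubar).mkQ w

/-- The multiplication map `(K ∩ A) × (K ∩ B) × (K ∩ C) → K` is bijective. -/
def IsFactorisation {G : Type*} [Group G] (K A B C : Subgroup G) : Prop :=
  Set.BijOn (fun x : G × G × G => x.1 * x.2.1 * x.2.2)
    (((K ⊓ A : Subgroup G) : Set G) ×ˢ ((K ⊓ B : Subgroup G) : Set G) ×ˢ
      ((K ⊓ C : Subgroup G) : Set G)) (K : Set G)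

/-- Compact open subgroups in good position. -/
structure IsWellPlaced {G : Type*} [Group G] [TopologicalSpace G] (p : ℕ) (U M Ubar K : Subgroup G) :
    Prop where
  isOpen : IsOpen (K : Set G)
  isProP : IsCompactProP p K
  factor₁ : IsFactorisation K U M Ubar
  factor₂ : IsFactorisation K U Ubar M
  factor₃ : IsFactorisation K M U Ubar
  factor₄ : IsFactorisation K M Ubar U
  factor₅ : IsFactorisation K Ubar U M
  factor₆ : IsFactorisation K Ubar M U

/-- The image `a H a⁻¹` of a subgroup under conjugation. -/
def conjSet {G : Type*} [Group G] (a : G) (H : Subgroup G) : Set G := (fun h => a * h * a⁻¹) '' H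

/-- `a` expands `N` starting from `K ∩ N`: the subgroups `aⁿ (K ∩ N) a⁻ⁿ` increase with `n ∈ ℕ` and
have union `N`, and the (decreasing) subgroups `a⁻ⁿ (K ∩ N) aⁿ` have trivial intersection. -/
structure Expands {G : Type*} [Group G] (a : G) (N K : Subgroup G) : Prop where
  mono : ((K ⊓ N : Subgroup G) : Set G) ⊆ conjSet a (K ⊓ N)
  union : ⋃ n : ℕ, conjSet (a ^ n) (K ⊓ N) = (N : Set G)
  inter : ⋂ n : ℕ, conjSet ((a ^ n)⁻¹) (K ⊓ N) = {1}

/-- `a` is a central element of `M` that is strictly positive: it expands `U`, and its inverse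
expands the opposite unipotent subgroup. -/
structure IsStrictlyPositiveElement {G : Type*} [Group G] (U M Ubar K : Subgroup G) (a : G) : Prop where
  mem : a ∈ M
  central : ∀ m ∈ M, a * m = m * a
  expands : Expands a U K
  expands_bar : Expands a⁻¹ Ubar K

end Jacquet

/-! Write `C` for `K ∩ Ubar` and `τ` for `⟨K λ K⟩`. Both sides of the natural map are governed by
`τ` acting on `V^K`. The basic computation is `heckeOp_pow`: for `v ∈ V^K`, `τⁿ v = ⟨C⟩ λⁿ v = ⟨K⟩
λⁿ v`. It holds because `λⁿ v` is fixed by `K ∩ M` and `K ∩ U`, `K = C (K ∩ M)(K ∩ U)`, and `λ C λ⁻¹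
⊆ C`.

The `K ∩ M`-fixed coinvariants are the inductive limit of `V^K` along `τ`. Indeed `⟨C⟩` is the
identity modulo `V(Ubar)`, so `τⁿ v` and `λⁿ v` have the same class, and a vector of `V^K` with zero
class is killed by some power of `τ` (`exists_heckeOp_pow_eq_zero`). Moreover, every fixed class
comes from `V^K` after translation by some `λʲ`.

The `K ∩ M`-fixed part of `iStar` is the projective limit of `V^K` along `τ`. A vector `x` gives the
sequence `y_j = (λ⁻ʲ x)_K` with `τ y_{j+1} = y_j` (`heckeOp_apply_rough`), which determines `x`
(`eq_zero_of_forall_apply_eq_zero`), and every such sequence occurs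
(`exists_mem_iStar_of_sequence`).

In these terms `Φ` sends `(y_j)` to the class of `y_0`. If `τⁿ` is stable with `n ≥ 1`, then `V = im
τⁿ ⊕ ker τⁿ` and `τ` is bijective on `im τⁿ ⊆ V^K`. Both limits are then identified with `im τⁿ`,
and `Φ` with the identity (`IsNaturalMap.bijOn_fixedVectors`). Smoothness on both sides yields the
statement for a sequence of subgroups shrinking to `1`.

The existence of `Φ` is a separate matter, since `x` need not be fixed by `K ∩ M`. It rests on small
compact open subgroups that factor through `Ubar`, an arbitrarily small part of `M`, and `U`
(`exists_adapted`). The algebraic groups enter only through `IsParabolicTriple`: closedness,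
normalisation by `M` and uniqueness of factorisations. -/

/-! ### Pro-`p` subgroups and the calculus of averaging projections -/

section Averaging

variable {R G V : Type*} [Ring R] [Group G] [TopologicalSpace G] [IsTopologicalGroup G]
  [AddCommGroup V] [Module R V] {p : ℕ} [Fact p.Prime]

/-- The conjugate `g H g⁻¹` of a subgroup. -/
def conjSubgroup {G : Type*} [Group G] (g : G) (H : Subgroup G) : Subgroup G :=
  H.map (MulAut.conj g).toMonoidHom

theorem mem_conjSubgroup {G : Type*} [Group G] {g x : G} {H : Subgroup G} :
    x ∈ conjSubgroup g H ↔ g⁻¹ * x * g ∈ H := by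
  constructor
  · rintro ⟨y, hy, rfl⟩
    simpa [mul_assoc] using hy
  · intro h
    exact ⟨_, h, by simp [mul_assoc]⟩

theorem conj_mem_conjSubgroup {G : Type*} [Group G] {g x : G} {H : Subgroup G} (hx : x ∈ H) :
    g * x * g⁻¹ ∈ conjSubgroup g H :=
  ⟨x, hx, rfl⟩

theorem conjSubgroup_one {G : Type*} [Group G] (H : Subgroup G) : conjSubgroup 1 H = H := by
  ext x; simp [mem_conjSubgroup]

theorem conjSubgroup_mul {G : Type*} [Group G] (a b : G) (H : Subgroup G) :
    conjSubgroup (a * b) H = conjSubgroup a (conjSubgroup b H) := by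
  ext x; simp [mem_conjSubgroup, mul_assoc]

theorem conjSubgroup_mono {G : Type*} [Group G] (a : G) {H H' : Subgroup G} (h : H ≤ H') :
    conjSubgroup a H ≤ conjSubgroup a H' :=
  Subgroup.map_mono h

theorem conjSubgroup_inf {G : Type*} [Group G] (a : G) (H H' : Subgroup G) :
    conjSubgroup a (H ⊓ H') = conjSubgroup a H ⊓ conjSubgroup a H' := by
  ext x; simp [mem_conjSubgroup]

theorem conjSubgroup_eq_self {G : Type*} [Group G] {a : G} {H : Subgroup G}
    (h : ∀ x ∈ H, a * x * a⁻¹ ∈ H) (h' : ∀ x ∈ H, a⁻¹ * x * a ∈ H) : conjSubgroup a H = H := by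
  ext x
  rw [mem_conjSubgroup]
  refine ⟨fun hx => ?_, h' x⟩
  simpa [mul_assoc] using h _ hx

omit [Fact p.Prime] in
theorem IsCompactProP.conjSubgroup {H : Subgroup G} (hH : IsCompactProP p H) (g : G) :
    IsCompactProP p (conjSubgroup g H) :=
  isCompactProP_map_conj hH g

theorem IsCompactProP.of_isOpen {H K : Subgroup G} (hK : IsCompactProP p K) (hHK : H ≤ K)
    (hH : IsOpen (H : Set G)) : IsCompactProP p H := by
  refine ⟨hK.1.of_isClosed_subset (H.isClosed_of_isOpen hH) hHK, fun S hS => ?_⟩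
  have h1 : IsOpen ((S.map H.subtype : Subgroup G) : Set G) := by
    rw [Subgroup.coe_map]
    exact hH.isOpenMap_subtype_val _ hS
  obtain ⟨k, hk⟩ := hK.2 ((S.map H.subtype).subgroupOf K) (h1.preimage continuous_subtype_val)
  have h2 : S.index ∣ p ^ k := by
    rw [← hk]
    change S.index ∣ (S.map H.subtype).relIndex K
    rw [← Subgroup.relIndex_mul_relIndex (S.map H.subtype) H K (Subgroup.map_subtype_le S) hHK]
    have h3 : (S.map H.subtype).relIndex H = S.index := by
      rw [Subgroup.relIndex, Subgroup.subgroupOf, Subgroup.comap_map_eq_self_of_injective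
        H.subtype_injective]
    rw [h3]
    exact dvd_mul_right _ _
  obtain ⟨j, -, hj⟩ := (Nat.dvd_prime_pow Fact.out).1 h2
  exact ⟨j, hj⟩

theorem exists_openNormal_of_isCompact [T2Space G] [TotallyDisconnectedSpace G] {K : Subgroup G}
    (hK : IsCompact (K : Set G)) {O : Set K} (hO : O ∈ nhds 1) :
    ∃ N : Subgroup K, N.Normal ∧ IsOpen (N : Set K) ∧ (N : Set K) ⊆ O := by
  have : CompactSpace K := isCompact_iff_compactSpace.1 hK
  obtain ⟨O', hO', hOo, h1⟩ := mem_nhds_iff.1 hO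
  obtain ⟨W, hW, h1W, hWO⟩ := compact_exists_isClopen_in_isOpen hOo h1
  obtain ⟨N, hN⟩ := IsTopologicalGroup.exist_openNormalSubgroup_sub_clopen_nhds_of_one hW h1W
  exact ⟨N.toSubgroup, N.isNormal', N.isOpen', hN.trans (hWO.trans hO')⟩

/-- An open subgroup `S` of `H` contains `H ∩ N` for some open normal `N` of `K`. Normality makes
`[H : H ∩ N]` divide `[K : N]`, a power of `p`. -/
theorem IsCompactProP.of_isClosed [T2Space G] [TotallyDisconnectedSpace G] {H K : Subgroup G}
    (hK : IsCompactProP p K) (hHK : H ≤ K) (hH : IsClosed (H : Set G)) : IsCompactProP p H := by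
  refine ⟨hK.1.of_isClosed_subset hH hHK, fun S hS => ?_⟩
  obtain ⟨O, hO, hOS⟩ := isOpen_induced_iff.1 hS
  have h1 : (Subtype.val ⁻¹' O : Set K) ∈ nhds 1 := by
    refine (hO.preimage continuous_subtype_val).mem_nhds ?_
    have : (1 : H) ∈ Subtype.val ⁻¹' O := by rw [hOS]; exact one_mem S
    exact this
  obtain ⟨N, hNn, hNo, hNO⟩ := exists_openNormal_of_isCompact hK.1 h1
  obtain ⟨k, hk⟩ := hK.2 N hNo
  have h2 : (N.comap (Subgroup.inclusion hHK)) ≤ S := by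
    intro x hx
    have h3 : (x : G) ∈ O := hNO hx
    have h4 : x ∈ Subtype.val ⁻¹' O := h3
    rw [hOS] at h4
    exact h4
  have h3 : (N.comap (Subgroup.inclusion hHK)).index ∣ N.index := by
    rw [Subgroup.index_comap]
    exact Subgroup.relIndex_dvd_index_of_normal _ _
  have h4 : S.index ∣ p ^ k := hk ▸ (Subgroup.index_dvd_of_le h2).trans h3
  obtain ⟨j, -, hj⟩ := (Nat.dvd_prime_pow Fact.out).1 h4
  exact ⟨j, hj⟩

namespace SmoothRep

variable (hp : IsUnit (p : R)) (σ : SmoothRep R G V)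

/-- The average is a mean over finitely many cosets, so a linear map that is constant on the orbit
keeps that constant value. Most identities between averages are instances of this principle. -/
theorem map_avg_of_forall {W : Type*} [AddCommGroup W] [Module R W] (f : V →ₗ[R] W)
    {H : Subgroup G} (hH : IsCompactProP p H) {v : V} {c : W}
    (h : ∀ g ∈ H, f (σ.act g v) = c) : f (σ.avg hp H hH v) = c := by
  have ho := σ.isOpen_fixer H v
  obtain ⟨b, hb⟩ := hH.2 _ ho
  have hf : (σ.fixer H v).FiniteIndex :=
    ⟨by rw [hb]; exact pow_ne_zero _ (Fact.out : p.Prime).ne_zero⟩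
  have : Fintype (H ⧸ σ.fixer H v) := Fintype.ofFinite _
  have hu : IsUnit ((σ.fixer H v).index : R) := by rw [hb]; exact isUnit_natCast_pow hp b
  change f (σ.avgFun H v) = c
  rw [σ.avgFun_eq hp hH v _ ho le_rfl, finsum_eq_sum_of_fintype, map_smul, map_sum,
    Finset.sum_congr rfl fun q _ => h _ (q.out : H).2, Finset.sum_const, Finset.card_univ,
    ← Nat.card_eq_fintype_card]
  change _ • (σ.fixer H v).index • c = c
  rw [← Nat.cast_smul_eq_nsmul R, smul_smul, Ring.inverse_mul_cancel _ hu, one_smul]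

theorem avg_eq_self {H : Subgroup G} (hH : IsCompactProP p H) {v : V}
    (h : ∀ g ∈ H, σ.act g v = v) : σ.avg hp H hH v = v :=
  σ.map_avg_of_forall hp LinearMap.id hH h

theorem avg_act {H : Subgroup G} (hH : IsCompactProP p H) {g : G} (hg : g ∈ H) (v : V) :
    σ.avg hp H hH (σ.act g v) = σ.avg hp H hH v := by
  have h : σ.orbit H (σ.act g v) = σ.orbit H v := by
    ext w
    constructor
    · rintro ⟨h, hh, rfl⟩
      exact ⟨h * g, mul_mem hh hg, by simp⟩
    · rintro ⟨h, hh, rfl⟩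
      exact ⟨h * g⁻¹, mul_mem hh (inv_mem hg), by
        rw [← Module.End.mul_apply, ← map_mul]; simp⟩
  change σ.avgFun H (σ.act g v) = σ.avgFun H v
  rw [avgFun, avgFun, h]

theorem avg_congr {H H' : Subgroup G} (hH : IsCompactProP p H) (hH' : IsCompactProP p H')
    (h : H = H') : σ.avg hp H hH = σ.avg hp H' hH' := by
  subst h; rfl

theorem act_avg_conj {H : Subgroup G} (hH : IsCompactProP p H) (g : G) (v : V) :
    σ.act g (σ.avg hp H hH v)
      = σ.avg hp (conjSubgroup g H) (hH.conjSubgroup g) (σ.act g v) := by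
  change σ.act g (σ.avgFun H v) = σ.avgFun (conjSubgroup g H) (σ.act g v)
  have hinj : Function.Injective (σ.act g) := fun a b h => by
    rw [← σ.act_inv_act g a, h, σ.act_inv_act]
  have ho : σ.orbit (conjSubgroup g H) (σ.act g v) = σ.act g '' σ.orbit H v := by
    ext w
    constructor
    · rintro ⟨_, ⟨h, hh, rfl⟩, rfl⟩
      refine ⟨_, ⟨h, hh, rfl⟩, ?_⟩
      simp only [← Module.End.mul_apply, ← map_mul]
      simp
    · rintro ⟨_, ⟨h, hh, rfl⟩, rfl⟩
      refine ⟨_, ⟨h, hh, rfl⟩, ?_⟩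
      simp only [← Module.End.mul_apply, ← map_mul]
      simp
  obtain ⟨k, hk⟩ := hH.2 _ (σ.isOpen_fixer H v)
  have hfin : (σ.fixer H v).FiniteIndex :=
    ⟨by rw [hk]; exact pow_ne_zero _ (Fact.out : p.Prime).ne_zero⟩
  have hof : (σ.orbit H v).Finite := by
    refine (Set.finite_range (fun q : H ⧸ σ.fixer H v => σ.act (q.out : H) v)).subset ?_
    rintro w ⟨h, hh, rfl⟩
    refine ⟨((⟨h, hh⟩ : H) : H ⧸ σ.fixer H v), ?_⟩
    exact σ.act_eq_of_quotient_eq le_rfl (b := ⟨h, hh⟩) (by simp)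
  rw [avgFun, avgFun, ho, map_smul, finsum_mem_image hinj.injOn, Nat.card_image_of_injective hinj]
  congr 1
  exact (σ.act g).toAddMonoidHom.map_finsum_mem (fun w => w) hof

theorem act_avg_of_normalizes {H : Subgroup G} (hH : IsCompactProP p H) {g : G}
    (hg : conjSubgroup g H = H) (v : V) :
    σ.act g (σ.avg hp H hH v) = σ.avg hp H hH (σ.act g v) := by
  rw [σ.act_avg_conj hp hH, σ.avg_congr hp _ hH hg]

theorem act_avg_of_mem {H : Subgroup G} (hH : IsCompactProP p H) {g : G} (hg : g ∈ H) (v : V) :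
    σ.act g (σ.avg hp H hH v) = σ.avg hp H hH v := by
  rw [σ.act_avg_of_normalizes hp hH, σ.avg_act hp hH hg]
  exact conjSubgroup_eq_self (fun x hx => mul_mem (mul_mem hg hx) (inv_mem hg))
    (fun x hx => mul_mem (mul_mem (inv_mem hg) hx) hg)

theorem avg_avg_of_le {H H' : Subgroup G} (hH : IsCompactProP p H) (hH' : IsCompactProP p H')
    (h : H' ≤ H) (v : V) : σ.avg hp H hH (σ.avg hp H' hH' v) = σ.avg hp H hH v :=
  σ.map_avg_of_forall hp _ hH' fun _ hg => σ.avg_act hp hH (h hg) v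

theorem avg_avg_of_ge {H H' : Subgroup G} (hH : IsCompactProP p H) (hH' : IsCompactProP p H')
    (h : H' ≤ H) (v : V) : σ.avg hp H' hH' (σ.avg hp H hH v) = σ.avg hp H hH v :=
  σ.avg_eq_self hp hH' fun _ hg => σ.act_avg_of_mem hp hH (h hg) v

/-- `⟨L⟩` commutes with every `c ∈ C`, so `⟨C⟩⟨L⟩⟨C⟩ v = ⟨C⟩⟨L⟩ v`, while `⟨L⟩⟨C⟩ v` is already
fixed by `C`. -/
theorem avg_comm {C L : Subgroup G} (hC : IsCompactProP p C) (hL : IsCompactProP p L)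
    (h : ∀ c ∈ C, conjSubgroup c L = L) (v : V) :
    σ.avg hp C hC (σ.avg hp L hL v) = σ.avg hp L hL (σ.avg hp C hC v) := by
  have h1 : (σ.avg hp C hC ∘ₗ σ.avg hp L hL) (σ.avg hp C hC v)
      = σ.avg hp C hC (σ.avg hp L hL v) := by
    refine σ.map_avg_of_forall hp _ hC fun c hc => ?_
    rw [LinearMap.comp_apply, ← σ.act_avg_of_normalizes hp hL (h c hc), σ.avg_act hp hC hc]
  rw [← h1, LinearMap.comp_apply]
  refine σ.avg_eq_self hp hC fun c hc => ?_
  rw [σ.act_avg_of_normalizes hp hL (h c hc), σ.act_avg_of_mem hp hC hc]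

/-- If `K = A B` as sets and `v` is fixed by `B`, then `⟨K⟩ v = ⟨A⟩ v`. -/
theorem avg_eq_avg_of_factor {K A : Subgroup G} (hK : IsCompactProP p K)
    (hA : IsCompactProP p A) (hAK : A ≤ K) {v : V}
    (h : ∀ k ∈ K, ∃ a ∈ A, σ.act k v = σ.act a v) : σ.avg hp A hA v = σ.avg hp K hK v := by
  rw [← σ.avg_avg_of_ge hp hK hA hAK]
  refine (σ.map_avg_of_forall hp _ hK fun k hk => ?_).symm
  obtain ⟨a, ha, hka⟩ := h k hk
  rw [hka, σ.avg_act hp hA ha]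

omit [IsTopologicalGroup G] in
theorem mkQ_act {N : Subgroup G} {g : G} (hg : g ∈ N) (v : V) :
    (σ.coinvKer N).mkQ (σ.act g v) = (σ.coinvKer N).mkQ v := by
  rw [← sub_eq_zero, ← map_sub]
  exact (Submodule.Quotient.mk_eq_zero _).2 (Submodule.subset_span ⟨g, hg, v, rfl⟩)

/-- Averaging over a subgroup of `N` is invisible in the coinvariants. This is why the class of `⟨C⟩
x` does not depend on `C`. -/
theorem mkQ_avg {N C : Subgroup G} (hC : IsCompactProP p C) (h : C ≤ N) (v : V) :
    (σ.coinvKer N).mkQ (σ.avg hp C hC v) = (σ.coinvKer N).mkQ v :=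
  σ.map_avg_of_forall hp _ hC fun _ hg => σ.mkQ_act (h hg) v

end SmoothRep

end Averaging

/-! ### Averages of elements of the roughening -/

section NaturalMap

variable {R G V : Type*} [Ring R] [Group G] [TopologicalSpace G] [IsTopologicalGroup G]
  [AddCommGroup V] [Module R V] {p : ℕ} [Fact p.Prime]

theorem conjSubgroup_eq_of_forall {G : Type*} [Group G] {C L : Subgroup G}
    (h : ∀ c ∈ C, ∀ l ∈ L, c * l * c⁻¹ ∈ L) : ∀ c ∈ C, conjSubgroup c L = L := fun c hc =>
  conjSubgroup_eq_self (h c hc) fun x hx => by simpa using h c⁻¹ (inv_mem hc) x hx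

/-- Small compact open pro-`p` subgroups that are normalised by a given compact subgroup. -/
theorem OpenProP.exists_normalized [T2Space G] [TotallyDisconnectedSpace G] (K : OpenProP p G)
    {C : Subgroup G} (hC : IsCompact (C : Set G)) {O : Set G} (hO : O ∈ nhds 1) :
    ∃ L : OpenProP p G, L.grp ≤ K.grp ∧ (L.grp : Set G) ⊆ O ∧
      ∀ c ∈ C, ∀ l ∈ L.grp, c * l * c⁻¹ ∈ L.grp := by
  obtain ⟨N, -, hNo, hN⟩ := exists_openNormal_of_isCompact K.isProP.1
    (O := Subtype.val ⁻¹' O) (continuous_subtype_val.continuousAt.preimage_mem_nhds (by simpa))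
  set N' : Subgroup G := N.map K.grp.subtype with hN'
  have hN'o : IsOpen (N' : Set G) := by
    rw [hN', Subgroup.coe_map]
    exact K.isOpen.isOpenMap_subtype_val _ hNo
  have hN'K : N' ≤ K.grp := Subgroup.map_subtype_le N
  have hN'O : (N' : Set G) ⊆ O := by
    rintro _ ⟨x, hx, rfl⟩
    exact hN hx
  let L : Subgroup G := ⨅ c : C, conjSubgroup (c : G) N'
  have hL : ∀ x, x ∈ L ↔ ∀ c ∈ C, c⁻¹ * x * c ∈ N' := by
    intro x
    simp only [L, Subgroup.mem_iInf, mem_conjSubgroup, Subtype.forall]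
  have hLN : L ≤ N' := fun x hx => by simpa using (hL x).1 hx 1 (one_mem C)
  have hLo : IsOpen (L : Set G) := by
    have hopen : IsOpen {q : G × G | q.1⁻¹ * q.2 * q.1 ∈ N'} :=
      hN'o.preimage (f := fun q : G × G => q.1⁻¹ * q.2 * q.1) (by fun_prop)
    -- An infinite intersection of conjugates need not be open. Here compactness of `C` provides one
    -- neighbourhood of `1` that all `c ∈ C` conjugate into `N'`.
    obtain ⟨A, B, -, hB, hCA, h1B, hAB⟩ := generalized_tube_lemma hC
      (isCompact_singleton (x := (1 : G))) hopen (by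
        rintro ⟨c, g⟩ ⟨-, hg⟩
        obtain rfl : g = 1 := hg
        simp [one_mem])
    refine L.isOpen_of_mem_nhds (Filter.mem_of_superset (hB.mem_nhds (h1B rfl)) fun g hg => ?_)
    exact (hL g).2 fun c hc => hAB (Set.mk_mem_prod (hCA hc) hg)
  refine ⟨⟨L, hLo, K.isProP.of_isOpen (hLN.trans hN'K) hLo⟩, hLN.trans hN'K,
    fun x hx => hN'O (hLN hx), fun c hc l hl => (hL _).2 fun d hd => ?_⟩
  have := (hL l).1 hl (c⁻¹ * d) (mul_mem (inv_mem hc) hd)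
  simpa [mul_assoc] using this

namespace SmoothRep

variable {hp : IsUnit (p : R)} {σ : SmoothRep R G V}

namespace IsAverage

variable {C C' : Subgroup G} {hC : IsCompactProP p C} {hC' : IsCompactProP p C'}
  {x y : OpenProP p G → V} {v w : V}

theorem add (hx : σ.IsAverage hp C hC x v) (hy : σ.IsAverage hp C hC y w) :
    σ.IsAverage hp C hC (x + y) (v + w) := fun L hL => by
  rw [Pi.add_apply, map_add, map_add, hx L hL, hy L hL]

theorem smul (r : R) (hx : σ.IsAverage hp C hC x v) : σ.IsAverage hp C hC (r • x) (r • v) :=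
  fun L hL => by rw [Pi.smul_apply, map_smul, map_smul, hx L hL]

theorem mono (h : C ≤ C') (hx : σ.IsAverage hp C hC x w) :
    σ.IsAverage hp C' hC' x (σ.avg hp C' hC' w) := fun L hL => by
  rw [← σ.avg_avg_of_le hp hC' hC h, hx L fun c hc => hL c (h hc),
    σ.avg_comm hp hC' L.isProP (conjSubgroup_eq_of_forall hL)]

theorem act (g : G) (hx : σ.IsAverage hp C hC x w) :
    σ.IsAverage hp (conjSubgroup g C) (hC.conjSubgroup g) (σ.roughAct p g x) (σ.act g w) := by
  intro L hL
  have hL' : ∀ c ∈ C, ∀ l ∈ (L.conj g⁻¹).grp, c * l * c⁻¹ ∈ (L.conj g⁻¹).grp := by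
    rintro c hc _ ⟨l, hl, rfl⟩
    refine ⟨_, hL _ (conj_mem_conjSubgroup hc) l hl, ?_⟩
    simp [mul_assoc]
  change σ.avg hp _ _ (σ.act g (x (L.conj g⁻¹))) = _
  rw [← σ.act_avg_conj hp hC, hx _ hL', σ.act_avg]
  refine congrFun (congrArg _ (σ.avg_congr hp _ _ ?_)) _
  rw [OpenProP.conj_conj, mul_inv_cancel, OpenProP.conj_one]

/-- For `L` small enough to fix both vectors and normalised by `C`, each of them equals `⟨C⟩ x_L`.
The subgroup `K` only serves to produce such an `L`. -/
theorem unique [T2Space G] [TotallyDisconnectedSpace G] (K : OpenProP p G)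
    (hv : σ.IsAverage hp C hC x v) (hw : σ.IsAverage hp C hC x w) : v = w := by
  obtain ⟨S, hS, hSv⟩ := σ.smooth v
  obtain ⟨T, hT, hTw⟩ := σ.smooth w
  obtain ⟨L, -, hLO, hLC⟩ := K.exists_normalized hC.1
    (Filter.inter_mem (hS.mem_nhds (one_mem S)) (hT.mem_nhds (one_mem T)))
  rw [← σ.avg_eq_self hp L.isProP fun g hg => hSv g (hLO hg).1,
    ← σ.avg_eq_self hp L.isProP fun g hg => hTw g (hLO hg).2, ← hv L hLC, hw L hLC]

theorem apply_eq [T2Space G] [TotallyDisconnectedSpace G] (hx : x ∈ σ.rough hp)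
    (h : σ.IsAverage hp C hC x w) (L : OpenProP p G) (hCL : C ≤ L.grp) :
    x L = σ.avg hp L.grp L.isProP w := by
  obtain ⟨L', hL', -, hLC⟩ := L.exists_normalized hC.1 Filter.univ_mem
  rw [← hx.2 L L' hL', ← σ.avg_avg_of_le hp L.isProP hC hCL, h L' hLC,
    σ.avg_avg_of_le hp _ _ hL']

/-- If `K = C · Stab(x)` in the sense of `h`, then `⟨C⟩ x = ⟨K⟩ x = x_K`, so the average lies in
`V`. This is the source of all averages in `V`. -/
theorem of_factor [T2Space G] [TotallyDisconnectedSpace G] (hx : x ∈ σ.rough hp)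
    (K : OpenProP p G) (hCK : C ≤ K.grp)
    (h : ∀ k ∈ K.grp, ∃ c ∈ C, ∃ g, σ.roughAct p g x = x ∧ k = c * g) :
    σ.IsAverage hp C hC x (x K) := by
  intro L hL
  obtain ⟨L', hL'K, hL'L, hL'⟩ := K.exists_normalized K.isProP.1 (L.isOpen.mem_nhds (one_mem _))
  have key : σ.avg hp C hC (x L') = x K := by
    rw [← hx.2 K L' hL'K]
    refine σ.avg_eq_avg_of_factor hp K.isProP hC hCK fun k hk => ?_
    obtain ⟨c, hc, g, hg, rfl⟩ := h k hk
    refine ⟨c, hc, ?_⟩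
    have hgK : g ∈ K.grp := by simpa using mul_mem (inv_mem (hCK hc)) hk
    have h1 : L'.conj g⁻¹ = L' :=
      OpenProP.ext (conjSubgroup_eq_of_forall hL' _ (inv_mem hgK))
    have h2 : σ.act g (x L') = x L' := by
      have h3 : σ.act g (x (L'.conj g⁻¹)) = x L' := congrFun hg L'
      rwa [h1] at h3
    rw [map_mul, Module.End.mul_apply, h2]
  rw [← hx.2 L L' hL'L, σ.avg_comm hp hC L.isProP (conjSubgroup_eq_of_forall hL), key]

end IsAverage

theorem mkQ_eq_of_isAverage [T2Space G] [TotallyDisconnectedSpace G] (K : OpenProP p G)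
    {N C C' : Subgroup G} {hC : IsCompactProP p C} {hC' : IsCompactProP p C'}
    {x : OpenProP p G → V} {w w' : V} (h : C ≤ C') (hN : C' ≤ N)
    (hw : σ.IsAverage hp C hC x w) (hw' : σ.IsAverage hp C' hC' x w') :
    (σ.coinvKer N).mkQ w = (σ.coinvKer N).mkQ w' := by
  rw [← (hw.mono h : σ.IsAverage hp C' hC' x _).unique K hw', σ.mkQ_avg hp hC' hN]

end SmoothRep

end NaturalMap

/-! ### Opposite unipotent subgroups, contraction by `λ`, and adapted subgroups -/

section ParabolicTriple

variable {R G V : Type*} [Ring R] [Group G] [TopologicalSpace G] [IsTopologicalGroup G]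
  [AddCommGroup V] [Module R V] {p : ℕ} [Fact p.Prime]

/-- The properties of the triple formed by the unipotent radicals of two opposite parabolic
subgroups and their common Levi subgroup `M`. -/
structure IsParabolicTriple {G : Type*} [Group G] [TopologicalSpace G] (U M Ubar : Subgroup G) :
    Prop where
  isClosed_U : IsClosed (U : Set G)
  isClosed_M : IsClosed (M : Set G)
  isClosed_Ubar : IsClosed (Ubar : Set G)
  conj_mem : ∀ m ∈ M, ∀ u ∈ U, m * u * m⁻¹ ∈ U
  conj_mem_bar : ∀ m ∈ M, ∀ u ∈ Ubar, m * u * m⁻¹ ∈ Ubar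
  inf_eq_bot : ∀ u ∈ U, u ∈ M → u = 1
  mul_inf_eq_bot : ∀ u ∈ U, ∀ m ∈ M, m * u ∈ Ubar → m * u = 1

namespace IsParabolicTriple

variable {U M Ubar K : Subgroup G} (T : IsParabolicTriple U M Ubar)
include T

omit [IsTopologicalGroup G] in
-- Cancelling puts `b'⁻¹ b` in `Ubar ∩ M U`, which is trivial. What remains is an element of `U ∩
-- M`, also trivial.
theorem factor_unique {b b' m m' a a' : G} (hb : b ∈ Ubar) (hb' : b' ∈ Ubar) (hm : m ∈ M)
    (hm' : m' ∈ M) (ha : a ∈ U) (ha' : a' ∈ U) (h : b * m * a = b' * m' * a') :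
    b = b' ∧ m = m' ∧ a = a' := by
  have h1 : b'⁻¹ * b = (m' * m⁻¹) * (m * (a' * a⁻¹) * m⁻¹) := by
    have : b = b' * m' * a' * a⁻¹ * m⁻¹ := by rw [← h]; group
    rw [this]; group
  have h2 : b'⁻¹ * b = 1 := by
    rw [h1]
    refine T.mul_inf_eq_bot _ (T.conj_mem _ hm _ (mul_mem ha' (inv_mem ha))) _
      (mul_mem hm' (inv_mem hm)) ?_
    rw [← h1]
    exact mul_mem (inv_mem hb') hb
  obtain rfl : b' = b := inv_mul_eq_one.1 h2
  have h3 : m * a = m' * a' := by simpa [mul_assoc] using h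
  have h4 : a * a'⁻¹ = m⁻¹ * m' := by
    have : a = m⁻¹ * (m' * a') := by rw [← h3]; group
    rw [this]; group
  have h5 : a * a'⁻¹ = 1 := by
    refine T.inf_eq_bot _ (mul_mem ha (inv_mem ha')) ?_
    rw [h4]
    exact mul_mem (inv_mem hm) hm'
  obtain rfl : a = a' := mul_inv_eq_one.1 h5
  exact ⟨rfl, mul_right_cancel h3, rfl⟩

omit [IsTopologicalGroup G] in
theorem conjSubgroup_U {m : G} (hm : m ∈ M) : conjSubgroup m U = U :=
  conjSubgroup_eq_self (T.conj_mem m hm) fun x hx => by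
    simpa using T.conj_mem _ (inv_mem hm) x hx

omit [IsTopologicalGroup G] in
theorem conjSubgroup_Ubar {m : G} (hm : m ∈ M) : conjSubgroup m Ubar = Ubar :=
  conjSubgroup_eq_self (T.conj_mem_bar m hm) fun x hx => by
    simpa using T.conj_mem_bar _ (inv_mem hm) x hx

end IsParabolicTriple

theorem conjSubgroup_of_mem {G : Type*} [Group G] {H : Subgroup G} {g : G} (hg : g ∈ H) :
    conjSubgroup g H = H :=
  conjSubgroup_eq_self (fun _ hx => mul_mem (mul_mem hg hx) (inv_mem hg))
    fun _ hx => mul_mem (mul_mem (inv_mem hg) hx) hg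

theorem conjSubgroup_conj_of_commute {G : Type*} [Group G] {H : Subgroup G} {s z : G}
    (hs : conjSubgroup s H = H) (hz : Commute z s) :
    conjSubgroup s (conjSubgroup z H) = conjSubgroup z H := by
  rw [← conjSubgroup_mul, ← hz.eq, conjSubgroup_mul, hs]

namespace Expands

variable {G : Type*} [Group G] {a : G} {N K : Subgroup G}

theorem le_conj (h : Expands a N K) : K ⊓ N ≤ conjSubgroup a (K ⊓ N) := h.mono

theorem le_conj_pow (h : Expands a N K) (n : ℕ) : K ⊓ N ≤ conjSubgroup (a ^ n) (K ⊓ N) := by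
  induction n with
  | zero => rw [pow_zero, conjSubgroup_one]
  | succ n ih =>
    rw [pow_succ, conjSubgroup_mul]
    exact ih.trans (conjSubgroup_mono _ h.le_conj)

theorem conj_pow_mono (h : Expands a N K) :
    Monotone fun n : ℕ => conjSubgroup (a ^ n) (K ⊓ N) := by
  intro m n hmn
  obtain ⟨k, rfl⟩ := Nat.exists_eq_add_of_le hmn
  change conjSubgroup (a ^ m) _ ≤ conjSubgroup (a ^ (m + k)) _
  rw [pow_add, conjSubgroup_mul]
  exact conjSubgroup_mono _ (h.le_conj_pow k)

theorem conj_pow_inv_anti (h : Expands a N K) :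
    Antitone fun n : ℕ => conjSubgroup (a ^ n)⁻¹ (K ⊓ N) := by
  intro m n hmn
  obtain ⟨k, rfl⟩ := Nat.exists_eq_add_of_le hmn
  change conjSubgroup (a ^ (m + k))⁻¹ _ ≤ conjSubgroup (a ^ m)⁻¹ _
  have h1 : (a ^ m)⁻¹ = (a ^ (m + k))⁻¹ * a ^ k := by
    rw [add_comm, pow_add]; group
  rw [h1, conjSubgroup_mul]
  exact conjSubgroup_mono _ (h.le_conj_pow k)

theorem exists_mem_conj (h : Expands a N K) {u : G} (hu : u ∈ N) :
    ∃ n : ℕ, ∀ m ≥ n, u ∈ conjSubgroup (a ^ m) (K ⊓ N) := by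
  have h1 : u ∈ (N : Set G) := hu
  rw [← h.union, Set.mem_iUnion] at h1
  obtain ⟨n, hn⟩ := h1
  exact ⟨n, fun m hm => h.conj_pow_mono hm hn⟩

/-- A decreasing sequence of compact sets with intersection `{1}` eventually enters every
neighbourhood of `1`. -/
theorem exists_conj_subset [TopologicalSpace G] [IsTopologicalGroup G] [T2Space G]
    (h : Expands a N K) (hc : IsCompact ((K ⊓ N : Subgroup G) : Set G)) {O : Set G}
    (hO : O ∈ nhds 1) :
    ∃ n : ℕ, ∀ m ≥ n, (conjSubgroup (a ^ m)⁻¹ (K ⊓ N) : Set G) ⊆ O := by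
  obtain ⟨n, hn⟩ := exists_subset_nhds_of_isCompact
    (V := fun n : ℕ => (conjSubgroup (a ^ n)⁻¹ (K ⊓ N) : Set G))
    (directed_of_isDirected_le fun m n hmn => h.conj_pow_inv_anti hmn)
    (fun n => hc.image (f := fun x => (a ^ n)⁻¹ * x * (a ^ n)⁻¹⁻¹) (by fun_prop)) (U := O) (by
      intro x hx
      have hx1 : x ∈ ⋂ n : ℕ, conjSet ((a ^ n)⁻¹) (K ⊓ N) := hx
      rw [h.inter] at hx1
      obtain rfl : x = 1 := hx1
      exact hO)
  exact ⟨n, fun m hm => Set.Subset.trans (h.conj_pow_inv_anti hm) hn⟩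

end Expands

theorem IsFactorisation.exists_eq {G : Type*} [Group G] {K A B C : Subgroup G}
    (h : IsFactorisation K A B C) {k : G} (hk : k ∈ K) :
    ∃ a ∈ K ⊓ A, ∃ b ∈ K ⊓ B, ∃ c ∈ K ⊓ C, k = a * b * c := by
  obtain ⟨⟨a, b, c⟩, ⟨ha, hb, hc⟩, rfl⟩ := h.surjOn hk
  exact ⟨a, ha, b, hb, c, hc, rfl⟩

/-- The group is `H = B S' A` with `A = λ⁻ⁿ (K ∩ U) λⁿ`, `B = λⁿ (K ∩ Ubar) λ⁻ⁿ` and `S' = K ∩ S`.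
For large `n` the factors `A` and `B` are so small that `a b` can be reordered into `B S' A`, while
`S'` normalises both because `λ` is central in `M`. The `M`-factor can thus be confined to any
prescribed open subgroup of `M`. -/
theorem IsParabolicTriple.exists_adapted [T2Space G] [TotallyDisconnectedSpace G]
    {U M Ubar K : Subgroup G} (T : IsParabolicTriple U M Ubar)
    (hK : IsWellPlaced p U M Ubar K) {l : G} (hl : IsStrictlyPositiveElement U M Ubar K l)
    {S : Subgroup M} (hS : IsOpen (S : Set M)) {O : Set G} (hO : O ∈ nhds 1) :
    ∃ H : OpenProP p G, ((H.grp ⊓ Ubar : Subgroup G) : Set G) ⊆ O ∧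
      ∀ k ∈ H.grp, ∃ b ∈ H.grp ⊓ Ubar, ∃ s ∈ S, ∃ a ∈ U, k = b * (s * a) := by
  have hKc := hK.isProP.1
  have hcU : IsCompact ((K ⊓ U : Subgroup G) : Set G) := hKc.inter_right T.isClosed_U
  have hcUbar : IsCompact ((K ⊓ Ubar : Subgroup G) : Set G) := hKc.inter_right T.isClosed_Ubar
  set S' : Subgroup G := K ⊓ S.map M.subtype with hS'
  have hS'M : S' ≤ M := inf_le_right.trans (Subgroup.map_subtype_le S)
  have hcD : IsCompact ((K : Set G) ∩ Subtype.val '' (S : Set M)ᶜ) :=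
    hKc.inter_right (T.isClosed_M.isClosedMap_subtype_val _ hS.isClosed_compl)
  set D : Set G := (K : Set G) ∩ Subtype.val '' (S : Set M)ᶜ with hD
  have hDM : D ⊆ ((K ⊓ M : Subgroup G) : Set G) := by
    rintro _ ⟨h1, ⟨m, -, rfl⟩⟩
    exact ⟨h1, m.2⟩
  -- `E` collects the elements of `K` whose `M`-component lies outside `S`. It is compact, hence
  -- closed, and misses `1` by uniqueness of factorisation, so elements of `K` close to `1` have
  -- their `M`-component in `S`.
  set E : Set G := (fun q : G × G × G => q.1 * q.2.1 * q.2.2) ''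
    (((K ⊓ Ubar : Subgroup G) : Set G) ×ˢ (D ×ˢ ((K ⊓ U : Subgroup G) : Set G))) with hE
  have hEc : IsClosed E := ((hcUbar.prod (hcD.prod hcU)).image (by fun_prop)).isClosed
  have hE1 : (1 : G) ∉ E := by
    rintro ⟨⟨b, m, a⟩, ⟨hb, hm, ha⟩, h⟩
    obtain ⟨-, rfl, -⟩ := T.factor_unique hb.2 (one_mem _) (hDM hm).2 (one_mem _) ha.2 (one_mem _)
      (by simpa using h : b * m * a = 1 * 1 * 1)
    obtain ⟨-, m, hmS, hm1⟩ := hm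
    obtain rfl : m = 1 := Subtype.ext hm1
    exact hmS (one_mem S)
  have hW : (K : Set G) ∩ Eᶜ ∈ nhds (1 : G) :=
    Filter.inter_mem (hK.isOpen.mem_nhds (one_mem K)) (hEc.isOpen_compl.mem_nhds hE1)
  obtain ⟨W, hWo, hW1, hWW⟩ := exists_open_nhds_one_mul_subset hW
  obtain ⟨n₁, hn₁⟩ := hl.expands.exists_conj_subset hcU (hWo.mem_nhds hW1)
  obtain ⟨n₂, hn₂⟩ := hl.expands_bar.exists_conj_subset hcUbar
    (Filter.inter_mem hO (hWo.mem_nhds hW1))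
  set n := max n₁ n₂ with hn
  set z : G := l ^ n with hz
  have hzM : z ∈ M := pow_mem hl.mem n
  have hzc : ∀ m ∈ M, Commute z m := fun m hm => Commute.pow_left (hl.central m hm) n
  set A : Subgroup G := conjSubgroup z⁻¹ (K ⊓ U) with hA
  set B : Subgroup G := conjSubgroup z (K ⊓ Ubar) with hB
  have hBz : conjSubgroup ((l⁻¹ ^ n)⁻¹) (K ⊓ Ubar) = B := by
    rw [hB, hz, inv_pow, inv_inv]
  have hAW : (A : Set G) ⊆ W := hn₁ n (le_max_left _ _)
  have hBW : (B : Set G) ⊆ O ∩ W := hBz ▸ hn₂ n (le_max_right _ _)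
  have hAU : A ≤ U := by
    rw [hA, conjSubgroup_inf, T.conjSubgroup_U (inv_mem hzM)]; exact inf_le_right
  have hBU : B ≤ Ubar := by
    rw [hB, conjSubgroup_inf, T.conjSubgroup_Ubar hzM]; exact inf_le_right
  have hAK : A ≤ K ⊓ U := by
    have h := hl.expands.conj_pow_inv_anti (Nat.zero_le n)
    simpa [conjSubgroup_one] using h
  have hBK : B ≤ K ⊓ Ubar := by
    have h := hl.expands_bar.conj_pow_inv_anti (Nat.zero_le n)
    simp only [pow_zero, inv_one, conjSubgroup_one] at h
    exact hBz ▸ h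
  have hA' : K ⊓ U ≤ conjSubgroup z (K ⊓ U) := hl.expands.le_conj_pow n
  have hB' : K ⊓ Ubar ≤ conjSubgroup z⁻¹ (K ⊓ Ubar) := by
    have h := hl.expands_bar.le_conj_pow n
    rwa [inv_pow] at h
  -- elements near `1` of both conjugates of `K` are products
  have key : ∀ k, k ∈ K → k ∉ E → z * k * z⁻¹ ∈ K → z⁻¹ * k * z ∈ K →
      ∃ b ∈ B, ∃ s ∈ S', ∃ a ∈ A, k = b * s * a := by
    intro k hk hkE h1 h2
    obtain ⟨b, hb, m, hm, a, ha, rfl⟩ := hK.factor₆.exists_eq hk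
    obtain ⟨b₁, hb₁, m₁, hm₁, a₁, ha₁, h1⟩ := hK.factor₆.exists_eq h1
    obtain ⟨b₂, hb₂, m₂, hm₂, a₂, ha₂, h2⟩ := hK.factor₆.exists_eq h2
    have e1 : b * m * a = (z⁻¹ * b₁ * z⁻¹⁻¹) * (z⁻¹ * m₁ * z) * (z⁻¹ * a₁ * z⁻¹⁻¹) := by
      have : b * m * a = z⁻¹ * (z * (b * m * a) * z⁻¹) * z := by group
      rw [this, h1]; group
    have e2 : b * m * a = (z * b₂ * z⁻¹) * (z * m₂ * z⁻¹) * (z * a₂ * z⁻¹) := by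
      have : b * m * a = z * (z⁻¹ * (b * m * a) * z) * z⁻¹ := by group
      rw [this, h2]; group
    -- Comparing the factorisation of `k` with that of `z k z⁻¹` puts the `U`-part in `A`. The
    -- comparison with `z⁻¹ k z` puts the `Ubar`-part in `B`.
    obtain ⟨-, -, f1⟩ := T.factor_unique hb.2 (T.conj_mem_bar _ (inv_mem hzM) _ hb₁.2) hm.2
      (mul_mem (mul_mem (inv_mem hzM) hm₁.2) hzM) ha.2 (T.conj_mem _ (inv_mem hzM) _ ha₁.2) e1
    obtain ⟨f2, -, -⟩ := T.factor_unique hb.2 (T.conj_mem_bar _ hzM _ hb₂.2) hm.2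
      (mul_mem (mul_mem hzM hm₂.2) (inv_mem hzM)) ha.2 (T.conj_mem _ hzM _ ha₂.2) e2
    refine ⟨b, f2 ▸ conj_mem_conjSubgroup hb₂, m, ?_, a, f1 ▸ conj_mem_conjSubgroup ha₁, rfl⟩
    by_contra hmS
    refine hkE ⟨(b, m, a), ⟨hb, ⟨hm.1, ⟨m, hm.2⟩, fun hS1 => hmS ?_, rfl⟩, ha⟩, rfl⟩
    exact ⟨hm.1, ⟨⟨m, hm.2⟩, hS1, rfl⟩⟩
  have hswap : ∀ a ∈ A, ∀ b ∈ B, ∃ b' ∈ B, ∃ s ∈ S', ∃ a' ∈ A, a * b = b' * s * a' := by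
    intro a ha b hb
    have h1 := hWW (Set.mul_mem_mul (hAW ha) (hBW hb).2)
    have ha2 := hA' (hAK ha)
    have hb2 := hB' (hBK hb)
    rw [hA, mem_conjSubgroup] at ha
    rw [hB, mem_conjSubgroup] at hb
    rw [mem_conjSubgroup] at ha2 hb2
    -- Conjugation by `z` expands `a` back into `K ∩ U` and contracts `b` further. Conjugation by
    -- `z⁻¹` does the opposite, so both conjugates of `a b` stay in `K`.
    refine key _ h1.1 h1.2 ?_ ?_
    · have := mul_mem ha.1 hb2.1
      simpa [mul_assoc] using this
    · have := mul_mem ha2.1 hb.1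
      simpa [mul_assoc] using this
  have hsA : ∀ s ∈ S', conjSubgroup s A = A := fun s hs =>
    conjSubgroup_conj_of_commute (by
      rw [conjSubgroup_inf, conjSubgroup_of_mem hs.1, T.conjSubgroup_U (hS'M hs)])
      (hzc s (hS'M hs)).inv_left
  have hsB : ∀ s ∈ S', conjSubgroup s B = B := fun s hs =>
    conjSubgroup_conj_of_commute (by
      rw [conjSubgroup_inf, conjSubgroup_of_mem hs.1, T.conjSubgroup_Ubar (hS'M hs)])
      (hzc s (hS'M hs))
  have hsA' : ∀ s ∈ S', ∀ a ∈ A, s⁻¹ * a * s ∈ A := fun s hs a ha => by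
    have : a ∈ conjSubgroup s A := by rwa [hsA s hs]
    exact mem_conjSubgroup.1 this
  have hsB' : ∀ s ∈ S', ∀ b ∈ B, s * b * s⁻¹ ∈ B := fun s hs b hb => by
    rw [← hsB s hs]
    exact conj_mem_conjSubgroup hb
  let H : Subgroup G :=
    { carrier := {k | ∃ b ∈ B, ∃ s ∈ S', ∃ a ∈ A, k = b * s * a}
      one_mem' := ⟨1, one_mem _, 1, one_mem _, 1, one_mem _, by simp⟩
      mul_mem' := by
        rintro _ _ ⟨b, hb, s, hs, a, ha, rfl⟩ ⟨b', hb', s', hs', a', ha', rfl⟩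
        obtain ⟨b₁, hb₁, s₁, hs₁, a₁, ha₁, h⟩ := hswap a ha b' hb'
        refine ⟨b * (s * b₁ * s⁻¹), mul_mem hb (hsB' s hs b₁ hb₁), s * s₁ * s',
          mul_mem (mul_mem hs hs₁) hs', s'⁻¹ * a₁ * s' * a',
          mul_mem (hsA' s' hs' a₁ ha₁) ha', ?_⟩
        have : b * s * a * (b' * s' * a') = b * s * (a * b') * s' * a' := by group
        rw [this, h]; group
      inv_mem' := by
        rintro _ ⟨b, hb, s, hs, a, ha, rfl⟩
        obtain ⟨b₁, hb₁, s₁, hs₁, a₁, ha₁, h⟩ := hswap (s⁻¹⁻¹ * a⁻¹ * s⁻¹)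
          (hsA' s⁻¹ (inv_mem hs) _ (inv_mem ha)) b⁻¹ (inv_mem hb)
        refine ⟨s⁻¹ * (b₁) * s⁻¹⁻¹, hsB' _ (inv_mem hs) _ hb₁, s⁻¹ * s₁ * 1,
          mul_mem (mul_mem (inv_mem hs) hs₁) (one_mem _), a₁, ha₁, ?_⟩
        have h' : s * a⁻¹ * s⁻¹ * b⁻¹ = b₁ * s₁ * a₁ := by simpa using h
        have : (b * s * a)⁻¹ = s⁻¹ * (s * a⁻¹ * s⁻¹ * b⁻¹) := by group
        rw [this, h']; group }
  have hHK : H ≤ K := by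
    rintro _ ⟨b, hb, s, hs, a, ha, rfl⟩
    exact mul_mem (mul_mem (hBK hb).1 hs.1) (hAK ha).1
  have hHo : IsOpen (H : Set G) := by
    have hc : ∀ y : G, (fun k : G => y * k * y⁻¹) ⁻¹' (K : Set G) ∈ nhds 1 := fun y =>
      (hK.isOpen.preimage (f := fun k : G => y * k * y⁻¹) (by fun_prop)).mem_nhds
        (by simp [one_mem])
    refine H.isOpen_of_mem_nhds (g := 1) (Filter.mem_of_superset
      (Filter.inter_mem hW (Filter.inter_mem (hc z) (hc z⁻¹))) ?_)
    rintro k ⟨h1, h2, h3⟩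
    exact key k h1.1 h1.2 h2 (by simpa using h3)
  have hBH : B ≤ H ⊓ Ubar := fun b hb =>
    ⟨⟨b, hb, 1, one_mem _, 1, one_mem _, by simp⟩, hBU hb⟩
  refine ⟨⟨H, hHo, hK.isProP.of_isOpen hHK hHo⟩, ?_, ?_⟩
  · rintro k ⟨⟨b, hb, s, hs, a, ha, hk⟩, hk'⟩
    obtain ⟨rfl, -, -⟩ := T.factor_unique hk' (hBU hb) (one_mem M) (hS'M hs) (one_mem U) (hAU ha)
      (by simpa using hk)
    exact (hBW hb).1
  · rintro _ ⟨b, hb, s, ⟨-, ⟨m, hm, rfl⟩⟩, a, ha, rfl⟩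
    exact ⟨b, hBH hb, m, hm, a, hAU ha, mul_assoc _ _ _⟩

end ParabolicTriple

/-! ### Existence, uniqueness and equivariance of the natural map -/

section NaturalMapExistence

variable {R G V : Type*} [Ring R] [Group G] [TopologicalSpace G] [IsTopologicalGroup G]
  [AddCommGroup V] [Module R V] {p : ℕ} [Fact p.Prime] [T2Space G] [TotallyDisconnectedSpace G]

omit [IsTopologicalGroup G] [T2Space G] [TotallyDisconnectedSpace G] in
theorem isOpen_inf_subgroupOf {H : Subgroup G} (hH : IsOpen (H : Set G)) (N : Subgroup G) :
    IsOpen (((H ⊓ N).subgroupOf N : Subgroup N) : Set N) := by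
  rw [Subgroup.inf_subgroupOf_right]
  exact hH.preimage continuous_subtype_val

namespace SmoothRep

variable {hp : IsUnit (p : R)} {σ : SmoothRep R G V} {U M Ubar K : Subgroup G}

/-- For `H` adapted to an open subgroup of `M` fixing `x`, the average of `x` over `H ∩ Ubar` is
`x_H ∈ V`. Such intersections are arbitrarily small, so every open `C` contains one, and averaging
further over `C` gives `⟨C⟩ x` in `V`. -/
theorem exists_isAverage_mkQ (T : IsParabolicTriple U M Ubar)
    (hK : IsWellPlaced p U M Ubar K) {l : G} (hl : IsStrictlyPositiveElement U M Ubar K l)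
    {x : OpenProP p G → V} (hx : x ∈ σ.iStar hp U M) :
    ∃ q : σ.jacquet Ubar, ∀ (C : Subgroup G) (hC : IsCompactProP p C), C ≤ Ubar →
      IsOpen ((C.subgroupOf Ubar : Subgroup Ubar) : Set Ubar) →
        ∃ w : V, σ.IsAverage hp C hC x w ∧ q = (σ.coinvKer Ubar).mkQ w := by
  obtain ⟨hx1, hxU, S, hS, hxS⟩ := hx
  have hC₁ : IsCompactProP p (K ⊓ Ubar) := hK.isProP.of_isClosed inf_le_left
    ((Subgroup.isClosed_of_isOpen K hK.isOpen).inter T.isClosed_Ubar)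
  have key : ∀ O ∈ nhds (1 : G), ∃ (C : Subgroup G) (hC : IsCompactProP p C) (w : V),
      (C : Set G) ⊆ O ∧ C ≤ Ubar ∧ σ.IsAverage hp C hC x w := by
    intro O hO
    obtain ⟨H, hHO, hH⟩ := T.exists_adapted hK hl hS hO
    have hHc : IsCompactProP p (H.grp ⊓ Ubar) := H.isProP.of_isClosed inf_le_left
      ((Subgroup.isClosed_of_isOpen H.grp H.isOpen).inter T.isClosed_Ubar)
    refine ⟨_, hHc, x H, hHO, inf_le_right,
      IsAverage.of_factor hx1 H inf_le_left fun k hk => ?_⟩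
    obtain ⟨b, hb, s, hs, a, ha, rfl⟩ := hH k hk
    refine ⟨b, hb, s * a, ?_, rfl⟩
    rw [map_mul, Module.End.mul_apply, hxU a ha, hxS s hs]
  have hsub : ∀ C : Subgroup G, IsOpen ((C.subgroupOf Ubar : Subgroup Ubar) : Set Ubar) →
      ∃ O ∈ nhds (1 : G), ∀ g ∈ O, g ∈ Ubar → g ∈ C := by
    intro C hC
    obtain ⟨O, hO, hOC⟩ := isOpen_induced_iff.1 hC
    have hmem : ∀ g : Ubar, (g : G) ∈ O ↔ (g : G) ∈ C := fun g => by
      have : g ∈ Subtype.val ⁻¹' O ↔ g ∈ ((C.subgroupOf Ubar : Subgroup Ubar) : Set Ubar) := by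
        rw [hOC]
      exact this
    exact ⟨O, hO.mem_nhds ((hmem 1).2 (one_mem C)), fun g hg hgU => (hmem ⟨g, hgU⟩).1 hg⟩
  let K' : OpenProP p G := ⟨K, hK.isOpen, hK.isProP⟩
  obtain ⟨O₁, hO₁, h₁⟩ := hsub _ (isOpen_inf_subgroupOf hK.isOpen Ubar)
  obtain ⟨C₀, hC₀, w₀, hC₀O, hC₀U, hw₀⟩ := key O₁ hO₁
  have hle₁ : C₀ ≤ K ⊓ Ubar := fun g hg => h₁ g (hC₀O hg) (hC₀U hg)
  have hw₁ : σ.IsAverage hp _ hC₁ x (σ.avg hp _ hC₁ w₀) := hw₀.mono hle₁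
  refine ⟨(σ.coinvKer Ubar).mkQ (σ.avg hp _ hC₁ w₀), fun C hC hCU hCo => ?_⟩
  obtain ⟨O, hO, h⟩ := hsub C hCo
  -- `C₂` lies in both `C` and `K ∩ Ubar`. The classes attached to these two groups are compared
  -- through that of `C₂`.
  obtain ⟨C₂, hC₂, w₂, hC₂O, hC₂U, hw₂⟩ := key _ (Filter.inter_mem hO hO₁)
  have hle : C₂ ≤ C := fun g hg => h g (hC₂O hg).1 (hC₂U hg)
  have hle' : C₂ ≤ K ⊓ Ubar := fun g hg => h₁ g (hC₂O hg).2 (hC₂U hg)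
  have hw : σ.IsAverage hp C hC x (σ.avg hp C hC w₂) := hw₂.mono hle
  exact ⟨_, hw, (mkQ_eq_of_isAverage K' hle' inf_le_right hw₂ hw₁).symm.trans
    (mkQ_eq_of_isAverage K' hle hCU hw₂ hw)⟩

theorem IsNaturalMap.eq_mkQ {Φ : σ.iStar hp U M →ₗ[R] σ.jacquet Ubar}
    (hΦ : σ.IsNaturalMap hp U M Ubar Φ) (K : OpenProP p G) {x : σ.iStar hp U M} {C : Subgroup G}
    {hC : IsCompactProP p C} (hCU : C ≤ Ubar)
    (hCo : IsOpen ((C.subgroupOf Ubar : Subgroup Ubar) : Set Ubar)) {w : V}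
    (hw : σ.IsAverage hp C hC x w) : Φ x = (σ.coinvKer Ubar).mkQ w := by
  obtain ⟨w', hw', h⟩ := hΦ x C hC hCU hCo
  rw [h, hw.unique K hw']

theorem exists_isNaturalMap (T : IsParabolicTriple U M Ubar)
    (hK : IsWellPlaced p U M Ubar K) {l : G} (hl : IsStrictlyPositiveElement U M Ubar K l) :
    ∃ Φ : σ.iStar hp U M →ₗ[R] σ.jacquet Ubar, σ.IsNaturalMap hp U M Ubar Φ := by
  choose f hf using fun x : σ.iStar hp U M => exists_isAverage_mkQ T hK hl x.2
  have hC : IsCompactProP p (K ⊓ Ubar) := hK.isProP.of_isClosed inf_le_left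
    ((Subgroup.isClosed_of_isOpen K hK.isOpen).inter T.isClosed_Ubar)
  have hCo := isOpen_inf_subgroupOf hK.isOpen Ubar
  let K' : OpenProP p G := ⟨K, hK.isOpen, hK.isProP⟩
  refine ⟨⟨⟨f, fun x y => ?_⟩, fun r x => ?_⟩, fun x C hC hCU hCo => hf x C hC hCU hCo⟩
  · obtain ⟨v, hv, hv'⟩ := hf x _ hC inf_le_right hCo
    obtain ⟨w, hw, hw'⟩ := hf y _ hC inf_le_right hCo
    obtain ⟨u, hu, hu'⟩ := hf (x + y) _ hC inf_le_right hCo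
    rw [hv', hw', hu', ← map_add, hu.unique K' (hv.add hw)]
  · obtain ⟨v, hv, hv'⟩ := hf x _ hC inf_le_right hCo
    obtain ⟨u, hu, hu'⟩ := hf (r • x) _ hC inf_le_right hCo
    change f (r • x) = r • f x
    rw [hv', hu', ← map_smul, hu.unique K' (hv.smul r)]

theorem IsNaturalMap.eq (T : IsParabolicTriple U M Ubar) (hK : IsWellPlaced p U M Ubar K)
    {Φ Ψ : σ.iStar hp U M →ₗ[R] σ.jacquet Ubar} (hΦ : σ.IsNaturalMap hp U M Ubar Φ)
    (hΨ : σ.IsNaturalMap hp U M Ubar Ψ) : Ψ = Φ := by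
  ext1 x
  have hC : IsCompactProP p (K ⊓ Ubar) := hK.isProP.of_isClosed inf_le_left
    ((Subgroup.isClosed_of_isOpen K hK.isOpen).inter T.isClosed_Ubar)
  have hCo := isOpen_inf_subgroupOf hK.isOpen Ubar
  obtain ⟨v, hv, hv'⟩ := hΦ x _ hC inf_le_right hCo
  rw [hv', hΨ.eq_mkQ ⟨K, hK.isOpen, hK.isProP⟩ inf_le_right hCo hv]

/-- `m ⟨C⟩ x = ⟨m C m⁻¹⟩ m x`, and `Φ (m x)` may be computed with the open subgroup `m C m⁻¹` of
`Ubar`. -/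
theorem IsNaturalMap.map_iStarAct (T : IsParabolicTriple U M Ubar)
    (hK : IsWellPlaced p U M Ubar K) {Φ : σ.iStar hp U M →ₗ[R] σ.jacquet Ubar}
    (hΦ : σ.IsNaturalMap hp U M Ubar Φ) (m : M) (x : σ.iStar hp U M) :
    Φ (σ.iStarAct hp T.conj_mem m x) = σ.jacquetAct T.conj_mem_bar m (Φ x) := by
  have hC : IsCompactProP p (K ⊓ Ubar) := hK.isProP.of_isClosed inf_le_left
    ((Subgroup.isClosed_of_isOpen K hK.isOpen).inter T.isClosed_Ubar)
  obtain ⟨v, hv, hv'⟩ := hΦ x _ hC inf_le_right (isOpen_inf_subgroupOf hK.isOpen Ubar)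
  have h1 : conjSubgroup (m : G) (K ⊓ Ubar) = conjSubgroup (m : G) K ⊓ Ubar := by
    rw [conjSubgroup_inf, T.conjSubgroup_Ubar m.2]
  rw [hv', hΦ.eq_mkQ ⟨K, hK.isOpen, hK.isProP⟩ (x := σ.iStarAct hp T.conj_mem m x)
    (h1.trans_le inf_le_right) (by
      rw [h1]; exact isOpen_inf_subgroupOf (isOpen_map_conj hK.isOpen _) Ubar) (hv.act (m : G))]
  rfl

end SmoothRep

end NaturalMapExistence

/-! ### Stable powers: `T` is bijective on the image of `Tⁿ` -/

section StableEnd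

variable {R V : Type*} [Ring R] [AddCommGroup V] [Module R V] {T : Module.End R V} {n : ℕ}

/-- If `w = Tⁿ v` and `T w = 0` with `n ≥ 1`, then `T²ⁿ v = 0`, and equality of kernels gives `Tⁿ v
= 0`. -/
theorem IsStableEnd.eq_zero_of_apply_eq_zero (h : IsStableEnd (T ^ n)) (hn : 1 ≤ n) {w : V}
    (hw : w ∈ LinearMap.range (T ^ n)) (hTw : T w = 0) : w = 0 := by
  obtain ⟨v, rfl⟩ := hw
  have h1 : v ∈ LinearMap.ker ((T ^ n) ^ 2) := by
    obtain ⟨k, rfl⟩ := Nat.exists_eq_add_of_le' hn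
    rw [LinearMap.mem_ker, pow_two, Module.End.mul_apply, pow_succ T k, Module.End.mul_apply,
      ← pow_succ, hTw, map_zero]
  rwa [← h.1] at h1

theorem IsStableEnd.eq_zero_of_pow_apply_eq_zero (h : IsStableEnd (T ^ n)) (hn : 1 ≤ n) (j : ℕ)
    {w : V} (hw : w ∈ LinearMap.range (T ^ n)) (hTw : (T ^ j) w = 0) : w = 0 := by
  induction j with
  | zero => simpa using hTw
  | succ j ih =>
    rw [pow_succ', Module.End.mul_apply] at hTw
    obtain ⟨v, rfl⟩ := hw
    refine ih (h.eq_zero_of_apply_eq_zero hn ⟨(T ^ j) v, ?_⟩ hTw)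
    rw [← Module.End.mul_apply, ← Module.End.mul_apply, ← pow_add, ← pow_add, add_comm]

/-- Since `w = T²ⁿ v`, the vector `Tⁿ (Tⁿ⁻¹ v)` is a preimage of `w` under `T` inside the image of
`Tⁿ`. -/
theorem IsStableEnd.exists_apply_eq (h : IsStableEnd (T ^ n)) (hn : 1 ≤ n) {w : V}
    (hw : w ∈ LinearMap.range (T ^ n)) : ∃ w' ∈ LinearMap.range (T ^ n), T w' = w := by
  rw [h.2] at hw
  obtain ⟨v, rfl⟩ := hw
  obtain ⟨k, rfl⟩ := Nat.exists_eq_add_of_le' hn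
  refine ⟨(T ^ (k + 1)) ((T ^ k) v), ⟨_, rfl⟩, ?_⟩
  simp only [← Module.End.mul_apply]
  rw [← pow_add, ← pow_succ', ← pow_mul]
  congr 2
  ring

/-- The spanning half of the Fitting decomposition `V = im Tⁿ + ker Tⁿ`. -/
theorem IsStableEnd.exists_sub_mem_ker (h : IsStableEnd (T ^ n)) (v : V) :
    ∃ w ∈ LinearMap.range (T ^ n), (T ^ n) (v - w) = 0 := by
  have h1 : (T ^ n) v ∈ LinearMap.range ((T ^ n) ^ 2) := h.2 ▸ ⟨v, rfl⟩
  obtain ⟨u, hu⟩ := h1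
  refine ⟨(T ^ n) u, ⟨u, rfl⟩, ?_⟩
  rw [map_sub, ← hu, pow_two, Module.End.mul_apply, sub_self]

end StableEnd

/-! ### The Hecke operator on `V^K` and on coinvariants -/

section SecondAdjointness

variable {R G V : Type*} [Ring R] [Group G] [TopologicalSpace G] [IsTopologicalGroup G]
  [AddCommGroup V] [Module R V] {p : ℕ} [Fact p.Prime]
  {U M Ubar K : Subgroup G} {l : G}

omit [IsTopologicalGroup G] in
theorem act_fixed_of_conj {σ : SmoothRep R G V} {H : Subgroup G} {g : G} {v : V}
    (h : ∀ k ∈ conjSubgroup g⁻¹ H, σ.act k v = v) : ∀ k ∈ H, σ.act k (σ.act g v) = σ.act g v := by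
  intro k hk
  have h1 : k * g = g * (g⁻¹ * k * g⁻¹⁻¹) := by group
  rw [← Module.End.mul_apply, ← map_mul, h1, map_mul, Module.End.mul_apply,
    h _ (conj_mem_conjSubgroup hk)]

omit [TopologicalSpace G] [IsTopologicalGroup G] in
theorem IsStrictlyPositiveElement.conjSubgroup_pow_inf_Ubar_le
    (hl : IsStrictlyPositiveElement U M Ubar K l) (n : ℕ) :
    conjSubgroup (l ^ n) (K ⊓ Ubar) ≤ K ⊓ Ubar := by
  have h := hl.expands_bar.conj_pow_inv_anti (Nat.zero_le n)
  simpa [conjSubgroup_one, inv_pow] using h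

namespace SmoothRep

variable {hp : IsUnit (p : R)} {σ : SmoothRep R G V}

theorem avg_inf_Ubar_eq (hK : IsWellPlaced p U M Ubar K) (hC : IsCompactProP p (K ⊓ Ubar)) {v : V}
    (hM : ∀ k ∈ K ⊓ M, σ.act k v = v) (hU : ∀ k ∈ K ⊓ U, σ.act k v = v) :
    σ.avg hp (K ⊓ Ubar) hC v = σ.avg hp K hK.isProP v := by
  refine σ.avg_eq_avg_of_factor hp hK.isProP hC inf_le_left fun k hk => ?_
  obtain ⟨b, hb, m, hm, a, ha, rfl⟩ := hK.factor₆.exists_eq hk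
  refine ⟨b, hb, ?_⟩
  rw [map_mul, map_mul, Module.End.mul_apply, Module.End.mul_apply, hU a ha, hM m hm]

theorem act_heckeOp (hK : IsCompactProP p K) {k : G} (hk : k ∈ K) (v : V) :
    σ.act k (σ.heckeOp hp K hK l v) = σ.heckeOp hp K hK l v :=
  σ.act_avg_of_mem hp hK hk _

omit [IsTopologicalGroup G] in
-- Invariance under the small group `λ⁻ⁿ (K ∩ U) λⁿ` is all that is required. Any smooth vector has
-- it for large `n`, not only the vectors of `V^K`.
theorem act_pow_fixed (hl : IsStrictlyPositiveElement U M Ubar K l) (n : ℕ) {v : V}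
    (hM : ∀ k ∈ K ⊓ M, σ.act k v = v)
    (hU : ∀ k ∈ conjSubgroup (l ^ n)⁻¹ (K ⊓ U), σ.act k v = v) :
    (∀ k ∈ K ⊓ M, σ.act k (σ.act (l ^ n) v) = σ.act (l ^ n) v) ∧
      ∀ k ∈ K ⊓ U, σ.act k (σ.act (l ^ n) v) = σ.act (l ^ n) v := by
  refine ⟨fun k hk => ?_, act_fixed_of_conj hU⟩
  have h1 : Commute (l ^ n) k := Commute.pow_left (hl.central k hk.2) n
  rw [← Module.End.mul_apply, ← map_mul, ← h1.eq, map_mul, Module.End.mul_apply, hM k hk]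

/-- The two averages agree by the factorisation of `K`. In the induction, `⟨C⟩ λ ⟨C⟩ λⁿ v = ⟨C⟩ ⟨λ C
λ⁻¹⟩ λⁿ⁺¹ v`, and the inner average is absorbed since `λ C λ⁻¹ ⊆ C`. -/
theorem heckeOp_pow (hK : IsWellPlaced p U M Ubar K) (hC : IsCompactProP p (K ⊓ Ubar))
    (hl : IsStrictlyPositiveElement U M Ubar K l) {v : V} (hv : ∀ k ∈ K, σ.act k v = v) (n : ℕ) :
    (σ.heckeOp hp K hK.isProP l ^ n) v = σ.avg hp (K ⊓ Ubar) hC (σ.act (l ^ n) v) ∧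
      (σ.heckeOp hp K hK.isProP l ^ n) v = σ.avg hp K hK.isProP (σ.act (l ^ n) v) := by
  have hfix : ∀ (j : ℕ) (w : V), (∀ k ∈ K, σ.act k w = w) →
      σ.avg hp (K ⊓ Ubar) hC (σ.act (l ^ j) w) = σ.avg hp K hK.isProP (σ.act (l ^ j) w) := by
    intro j w hw
    obtain ⟨h1, h2⟩ := act_pow_fixed hl j (fun k hk => hw k hk.1) (fun k hk => hw k (by
      have h := hl.expands.conj_pow_inv_anti (Nat.zero_le j) hk
      simp only [pow_zero, inv_one, conjSubgroup_one] at h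
      exact h.1))
    exact avg_inf_Ubar_eq hK hC h1 h2
  refine (fun h => ⟨h, h.trans (hfix n v hv)⟩) ?_
  induction n with
  | zero =>
    rw [pow_zero, pow_zero, map_one, Module.End.one_apply,
      σ.avg_eq_self hp hC fun k hk => hv k hk.1]
  | succ n ih =>
    have h1 : ∀ k ∈ K, σ.act k (σ.avg hp (K ⊓ Ubar) hC (σ.act (l ^ n) v))
        = σ.avg hp (K ⊓ Ubar) hC (σ.act (l ^ n) v) := fun k hk => by
      rw [hfix n v hv, σ.act_avg_of_mem hp hK.isProP hk]
    have h2 := hfix 1 _ h1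
    rw [pow_one] at h2
    have hle : conjSubgroup l (K ⊓ Ubar) ≤ K ⊓ Ubar := by
      simpa using hl.conjSubgroup_pow_inf_Ubar_le 1
    rw [pow_succ', Module.End.mul_apply, ih, heckeOp, Module.End.mul_apply, Module.End.mul_apply,
      σ.avg_eq_self hp hK.isProP h1, ← h2, σ.act_avg_conj hp hC, σ.avg_avg_of_le hp hC _ hle,
      ← Module.End.mul_apply (σ.act l), ← map_mul, ← pow_succ']

theorem mkQ_heckeOp_pow (hK : IsWellPlaced p U M Ubar K) (hC : IsCompactProP p (K ⊓ Ubar))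
    (hl : IsStrictlyPositiveElement U M Ubar K l) {v : V} (hv : ∀ k ∈ K, σ.act k v = v) (n : ℕ) :
    (σ.coinvKer Ubar).mkQ ((σ.heckeOp hp K hK.isProP l ^ n) v)
      = (σ.coinvKer Ubar).mkQ (σ.act (l ^ n) v) := by
  rw [(heckeOp_pow hK hC hl hv n).1, σ.mkQ_avg hp hC inf_le_right]

/-- Every `u ∈ Ubar` lies in `λ⁻ᵐ C λᵐ` for all large `m`, and averaging over a group containing `u`
kills `u v - v`. -/
theorem exists_avg_eq_zero (hC : IsCompactProP p (K ⊓ Ubar))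
    (hl : IsStrictlyPositiveElement U M Ubar K l) {v : V} (hv : v ∈ σ.coinvKer Ubar) :
    ∃ n : ℕ, ∀ m ≥ n, σ.avg hp (conjSubgroup (l⁻¹ ^ m) (K ⊓ Ubar)) (hC.conjSubgroup _) v = 0 := by
  induction hv using Submodule.span_induction with
  | mem w hw =>
    obtain ⟨u, hu, v, rfl⟩ := hw
    obtain ⟨n, hn⟩ := hl.expands_bar.exists_mem_conj hu
    exact ⟨n, fun m hm => by rw [map_sub, σ.avg_act hp _ (hn m hm), sub_self]⟩
  | zero => exact ⟨0, fun _ _ => map_zero _⟩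
  | add v w _ _ hv hw =>
    obtain ⟨n, hn⟩ := hv
    obtain ⟨n', hn'⟩ := hw
    exact ⟨max n n', fun m hm => by
      rw [map_add, hn m (le_of_max_le_left hm), hn' m (le_of_max_le_right hm), add_zero]⟩
  | smul r v _ hv =>
    obtain ⟨n, hn⟩ := hv
    exact ⟨n, fun m hm => by rw [map_smul, hn m hm, smul_zero]⟩

/-- Translating `⟨λ⁻ⁿ C λⁿ⟩ v = 0` by `λⁿ` gives `⟨C⟩ λⁿ v = 0`, and the left side is `τⁿ v`. -/
theorem exists_heckeOp_pow_eq_zero (hK : IsWellPlaced p U M Ubar K)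
    (hC : IsCompactProP p (K ⊓ Ubar)) (hl : IsStrictlyPositiveElement U M Ubar K l) {v : V}
    (hv : ∀ k ∈ K, σ.act k v = v) (h : (σ.coinvKer Ubar).mkQ v = 0) :
    ∃ n : ℕ, (σ.heckeOp hp K hK.isProP l ^ n) v = 0 := by
  obtain ⟨n, hn⟩ := exists_avg_eq_zero (hp := hp) hC hl ((Submodule.Quotient.mk_eq_zero _).1 h)
  refine ⟨n, ?_⟩
  have h1 := congrArg (σ.act (l ^ n)) (hn n le_rfl)
  rw [map_zero, σ.act_avg_conj] at h1
  rw [(heckeOp_pow hK hC hl hv n).1, ← h1]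
  refine congrFun (congrArg _ (σ.avg_congr hp _ _ ?_)) _
  rw [← conjSubgroup_mul, inv_pow, mul_inv_cancel, conjSubgroup_one]

theorem mkQ_eq_of_mkQ_act_eq (hMU : ∀ m ∈ M, ∀ u ∈ Ubar, m * u * m⁻¹ ∈ Ubar) {m : G} (hm : m ∈ M)
    {v w : V} (h : (σ.coinvKer Ubar).mkQ (σ.act m v) = (σ.coinvKer Ubar).mkQ (σ.act m w)) :
    (σ.coinvKer Ubar).mkQ v = (σ.coinvKer Ubar).mkQ w := by
  have h1 : ∀ u, σ.jacquetAct hMU (⟨m, hm⟩ : M)⁻¹ ((σ.coinvKer Ubar).mkQ (σ.act m u))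
      = (σ.coinvKer Ubar).mkQ u := fun u => by
    change (σ.coinvKer Ubar).mkQ (σ.act m⁻¹ (σ.act m u)) = _
    rw [σ.act_inv_act]
  rw [← h1 v, h, h1 w]

/-! ### The `K ∩ M`-fixed rough vectors as a projective limit, and bijectivity -/

section

variable [T2Space G] [TotallyDisconnectedSpace G]

theorem isAverage_apply (hK : IsWellPlaced p U M Ubar K) (hC : IsCompactProP p (K ⊓ Ubar))
    {x : OpenProP p G → V} (hx : x ∈ σ.iStar hp U M)
    (hxK : ∀ m ∈ K ⊓ M, σ.roughAct p m x = x) :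
    σ.IsAverage hp (K ⊓ Ubar) hC x (x ⟨K, hK.isOpen, hK.isProP⟩) := by
  refine IsAverage.of_factor hx.1 ⟨K, hK.isOpen, hK.isProP⟩ inf_le_left fun k hk => ?_
  obtain ⟨b, hb, m, hm, a, ha, rfl⟩ := hK.factor₆.exists_eq hk
  refine ⟨b, hb, m * a, ?_, mul_assoc _ _ _⟩
  rw [map_mul, Module.End.mul_apply, hx.2.1 a ha.2, hxK m hm]

/-- Here `x_K = ⟨C⟩ x`, so `⟨C⟩ λ x_K = ⟨C⟩ ⟨λ C λ⁻¹⟩ λ x = ⟨C⟩ λ x`. -/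
theorem heckeOp_apply_rough (T : IsParabolicTriple U M Ubar) (hK : IsWellPlaced p U M Ubar K)
    (hC : IsCompactProP p (K ⊓ Ubar)) (hl : IsStrictlyPositiveElement U M Ubar K l)
    {x : OpenProP p G → V} (hx : x ∈ σ.iStar hp U M)
    (hxK : ∀ m ∈ K ⊓ M, σ.roughAct p m x = x) :
    σ.heckeOp hp K hK.isProP l (x ⟨K, hK.isOpen, hK.isProP⟩)
      = σ.roughAct p l x ⟨K, hK.isOpen, hK.isProP⟩ := by
  set K' : OpenProP p G := ⟨K, hK.isOpen, hK.isProP⟩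
  have h1 : σ.IsAverage hp (K ⊓ Ubar) hC (σ.roughAct p l x) _ :=
    ((isAverage_apply hK hC hx hxK).act l).mono
      (by simpa using hl.conjSubgroup_pow_inf_Ubar_le 1)
  have h2 := isAverage_apply hK hC (σ.roughAct_mem_iStar hp T.conj_mem ⟨l, hl.mem⟩ x hx)
    fun m hm => by
      have h3 : m * l = l * m := (hl.central m hm.2).symm
      rw [← Module.End.mul_apply, ← map_mul, h3, map_mul, Module.End.mul_apply, hxK m hm]
  have h3 := (heckeOp_pow (hp := hp) hK hC hl (hx.1.1 K') 1).1
  rw [pow_one, pow_one] at h3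
  rw [h3]
  exact h1.unique K' h2

/-- The vector `λⁿ (λ⁻ⁿ x)_K` is the average of `x` over `λⁿ C λ⁻ⁿ`. Once this group lies in `L`,
that vector determines `x_L`. -/
theorem eq_zero_of_forall_apply_eq_zero (T : IsParabolicTriple U M Ubar)
    (hK : IsWellPlaced p U M Ubar K) (hC : IsCompactProP p (K ⊓ Ubar))
    (hl : IsStrictlyPositiveElement U M Ubar K l)
    {x : OpenProP p G → V} (hx : x ∈ σ.iStar hp U M)
    (hxK : ∀ m ∈ K ⊓ M, σ.roughAct p m x = x)
    (h : ∀ n : ℕ, σ.roughAct p (l ^ n)⁻¹ x ⟨K, hK.isOpen, hK.isProP⟩ = 0) : x = 0 := by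
  funext L
  obtain ⟨n, hn⟩ := hl.expands_bar.exists_conj_subset hC.1 (L.isOpen.mem_nhds (one_mem L.grp))
  have h0 := hn n le_rfl
  rw [inv_pow, inv_inv] at h0
  have h1 := isAverage_apply hK hC
    (σ.roughAct_mem_iStar hp T.conj_mem ⟨(l ^ n)⁻¹, inv_mem (pow_mem hl.mem n)⟩ x hx)
    fun m hm => by
      have h3 : m * (l ^ n)⁻¹ = (l ^ n)⁻¹ * m :=
        ((Commute.pow_left (hl.central m hm.2) n).inv_left).symm
      rw [← Module.End.mul_apply, ← map_mul, h3, map_mul, Module.End.mul_apply, hxK m hm]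
  have h2 := h1.act (l ^ n)
  rw [h n, map_zero] at h2
  simp only [← Module.End.mul_apply, ← map_mul, mul_inv_cancel, map_one, Module.End.one_apply] at h2
  rw [h2.apply_eq hx.1 L h0, map_zero, Pi.zero_apply]

omit [TotallyDisconnectedSpace G] in
-- The vectors `z_n = λⁿ y_n` satisfy `⟨λⁿ C λ⁻ⁿ⟩ z_{n+1} = z_n`, so `⟨L⟩ z_n` is constant once `λⁿ
-- C λ⁻ⁿ ⊆ L`. The eventual values form `x`. It is `U`-invariant because `z_n` is fixed by `λⁿ (K ∩
-- U) λ⁻ⁿ`, and these groups exhaust `U`.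
theorem exists_mem_iStar_of_sequence (hK : IsWellPlaced p U M Ubar K)
    (hC : IsCompactProP p (K ⊓ Ubar)) (hl : IsStrictlyPositiveElement U M Ubar K l)
    {y : ℕ → V} (hyK : ∀ n, ∀ k ∈ K, σ.act k (y n) = y n)
    (hy : ∀ n, σ.heckeOp hp K hK.isProP l (y (n + 1)) = y n) :
    ∃ x ∈ σ.iStar hp U M, (∀ m ∈ K ⊓ M, σ.roughAct p m x = x) ∧
      x ⟨K, hK.isOpen, hK.isProP⟩ = y 0 := by
  set z : ℕ → V := fun n => σ.act (l ^ n) (y n) with hz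
  have hz1 : ∀ n, σ.avg hp _ (hC.conjSubgroup (l ^ n)) (z (n + 1)) = z n := by
    intro n
    have h1 := (heckeOp_pow (hp := hp) hK hC hl (hyK (n + 1)) 1).1
    rw [pow_one, pow_one, hy] at h1
    have h2 : z (n + 1) = σ.act (l ^ n) (σ.act l (y (n + 1))) := by
      rw [← Module.End.mul_apply, ← map_mul, ← pow_succ]
    rw [h2, ← σ.act_avg_conj hp hC, ← h1]
  have hlim : ∀ L : OpenProP p G, ∃ (w : V) (n : ℕ), ∀ m ≥ n,
      σ.avg hp L.grp L.isProP (z m) = w := by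
    intro L
    obtain ⟨n, hn⟩ := hl.expands_bar.exists_conj_subset hC.1 (L.isOpen.mem_nhds (one_mem L.grp))
    refine ⟨σ.avg hp L.grp L.isProP (z n), n, fun m hm => ?_⟩
    induction m, hm using Nat.le_induction with
    | base => rfl
    | succ m hm ih =>
      have h0 := hn m hm
      rw [inv_pow, inv_inv] at h0
      rw [← σ.avg_avg_of_le hp L.isProP (hC.conjSubgroup (l ^ m)) h0, hz1, ih]
  choose x N hN using hlim
  have hrough : x ∈ σ.rough hp := by
    refine ⟨fun L g hg => ?_, fun L L' hL => ?_⟩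
    · rw [← hN L _ le_rfl, σ.act_avg_of_mem hp L.isProP hg]
    · rw [← hN L (max (N L) (N L')) (le_max_left _ _), ← hN L' _ (le_max_right (N L) (N L')),
        σ.avg_avg_of_le hp _ _ hL]
  have hfix : ∀ g, (∃ n, ∀ m ≥ n, σ.act g (z m) = z m) → σ.roughAct p g x = x := by
    rintro g ⟨n, hn⟩
    funext L
    change σ.act g (x (L.conj g⁻¹)) = x L
    set m := max n (max (N L) (N (L.conj g⁻¹)))
    rw [← hN L m (le_max_of_le_right (le_max_left _ _)),
      ← hN (L.conj g⁻¹) m (le_max_of_le_right (le_max_right _ _)), σ.act_avg,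
      hn m (le_max_left _ _)]
    refine congrFun (congrArg _ (σ.avg_congr hp _ _ ?_)) _
    rw [OpenProP.conj_conj, mul_inv_cancel, OpenProP.conj_one]
  have hfixM : ∀ m ∈ K ⊓ M, σ.roughAct p m x = x := fun m hm => hfix m ⟨0, fun n _ => by
    have h1 : m * l ^ n = l ^ n * m := (Commute.pow_left (hl.central m hm.2) n).symm.eq
    rw [← Module.End.mul_apply, ← map_mul, h1, map_mul, Module.End.mul_apply, hyK n m hm.1]⟩
  refine ⟨x, ⟨hrough, fun u hu => hfix u ?_, K.subgroupOf M,
    hK.isOpen.preimage continuous_subtype_val, fun m hm => hfixM m ⟨hm, m.2⟩⟩, hfixM, ?_⟩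
  · obtain ⟨n, hn⟩ := hl.expands.exists_mem_conj hu
    refine ⟨n, fun m hm => ?_⟩
    have h1 := mem_conjSubgroup.1 (hn m hm)
    have h2 : u * l ^ m = l ^ m * ((l ^ m)⁻¹ * u * l ^ m) := by group
    rw [← Module.End.mul_apply, ← map_mul, h2, map_mul, Module.End.mul_apply, hyK m _ h1.1]
  · have h1 : ∀ n, (σ.heckeOp hp K hK.isProP l ^ n) (y n) = y 0 := by
      intro n
      induction n with
      | zero => rfl
      | succ n ih => rw [pow_succ, Module.End.mul_apply, hy, ih]
    rw [← hN _ _ le_rfl, ← h1, (heckeOp_pow hK hC hl (hyK _) _).2]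

/-- If a power of `⟨K l K⟩` is stable, the natural map restricts to a bijection between the
vectors fixed by `K ∩ M`. -/
theorem IsNaturalMap.bijOn_fixedVectors (T : IsParabolicTriple U M Ubar)
    (hK : IsWellPlaced p U M Ubar K) (hl : IsStrictlyPositiveElement U M Ubar K l)
    {Φ : σ.iStar hp U M →ₗ[R] σ.jacquet Ubar} (hΦ : σ.IsNaturalMap hp U M Ubar Φ)
    {n : ℕ} (hn : 1 ≤ n) (hstab : IsStableEnd (σ.heckeOp hp K hK.isProP l ^ n)) :
    Set.BijOn Φ (fixedVectors (σ.iStarAct hp T.conj_mem) (K.subgroupOf M))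
      (fixedVectors (σ.jacquetAct T.conj_mem_bar) (K.subgroupOf M)) := by
  have hKcl := Subgroup.isClosed_of_isOpen K hK.isOpen
  have hC : IsCompactProP p (K ⊓ Ubar) :=
    hK.isProP.of_isClosed inf_le_left (hKcl.inter T.isClosed_Ubar)
  have hCM : IsCompactProP p (K ⊓ M) :=
    hK.isProP.of_isClosed inf_le_left (hKcl.inter T.isClosed_M)
  set τ := σ.heckeOp hp K hK.isProP l with hτ
  set K' : OpenProP p G := ⟨K, hK.isOpen, hK.isProP⟩ with hK'
  have hfixed : ∀ x ∈ fixedVectors (σ.iStarAct hp T.conj_mem) (K.subgroupOf M),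
      ∀ m ∈ K ⊓ M, σ.roughAct p m x = x := fun x hx m hm =>
    congrArg Subtype.val (hx ⟨m, hm.2⟩ hm.1)
  have hΦK : ∀ x ∈ fixedVectors (σ.iStarAct hp T.conj_mem) (K.subgroupOf M),
      Φ x = (σ.coinvKer Ubar).mkQ (x.1 K') := fun x hx =>
    hΦ.eq_mkQ K' inf_le_right (isOpen_inf_subgroupOf hK.isOpen Ubar)
      (isAverage_apply hK hC x.2 (hfixed x hx))
  have hWfix : ∀ w ∈ LinearMap.range (τ ^ n), ∀ k ∈ K, σ.act k w = w := by
    intro w hw k hk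
    obtain ⟨w', -, rfl⟩ := hstab.exists_apply_eq hn hw
    exact act_heckeOp hK.isProP hk w'
  refine ⟨fun x hx m hm => ?_, ?_, fun q hq => ?_⟩
  · rw [← hΦ.map_iStarAct T hK, hx m hm]
  · have hinj : ∀ x ∈ fixedVectors (σ.iStarAct hp T.conj_mem) (K.subgroupOf M), Φ x = 0 → x = 0 := by
      intro x hx hx0
      have hxK := hfixed x hx
      set y : ℕ → V := fun j => σ.roughAct p (l ^ j)⁻¹ x.1 K' with hy
      have hiS : ∀ j : ℕ, σ.roughAct p (l ^ j)⁻¹ x.1 ∈ σ.iStar hp U M := fun j =>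
        σ.roughAct_mem_iStar hp T.conj_mem ⟨(l ^ j)⁻¹, inv_mem (pow_mem hl.mem j)⟩ x x.2
      have hstep : ∀ j, τ (y (j + 1)) = y j := by
        intro j
        have h1 := heckeOp_apply_rough T hK hC hl (hiS (j + 1)) fun m hm => by
          have h3 : m * (l ^ (j + 1))⁻¹ = (l ^ (j + 1))⁻¹ * m :=
            ((Commute.pow_left (hl.central m hm.2) (j + 1)).inv_left).symm
          rw [← Module.End.mul_apply, ← map_mul, h3, map_mul, Module.End.mul_apply, hxK m hm]
        have h2 : l * (l ^ (j + 1))⁻¹ = (l ^ j)⁻¹ := by rw [pow_succ]; group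
        rw [hy, hτ]
        dsimp only
        rw [h1, ← Module.End.mul_apply, ← map_mul, h2]
      have hpow : ∀ i j, (τ ^ i) (y (j + i)) = y j := by
        intro i j
        induction i with
        | zero => rfl
        | succ i ih => rw [pow_succ, Module.End.mul_apply, ← add_assoc, hstep, ih]
      have hy0 : y 0 = x.1 K' := by
        simp [hy]
      rw [hΦK x hx, ← hy0] at hx0
      obtain ⟨N, hN⟩ := exists_heckeOp_pow_eq_zero hK hC hl ((hiS 0).1.1 K') hx0
      refine Subtype.ext (eq_zero_of_forall_apply_eq_zero T hK hC hl x.2 hxK fun j => ?_)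
      -- Each `y_j = τⁿ y_{j+n}` lies in the image of `τⁿ`, where `τ` is injective, and `τ^{N+j} y_j
      -- = τ^N y_0 = 0`.
      refine hstab.eq_zero_of_pow_apply_eq_zero hn (N + j) ⟨y (j + n), hpow n j⟩ ?_
      have h2 := hpow j 0
      rw [zero_add] at h2
      rw [pow_add, Module.End.mul_apply, h2, hN]
    intro x hx x' hx' h
    exact sub_eq_zero.1 (hinj _ (sub_mem hx hx') (by rw [map_sub, h, sub_self]))
  · obtain ⟨v₀, rfl⟩ := (σ.coinvKer Ubar).mkQ_surjective q
    set v := σ.avg hp (K ⊓ M) hCM v₀ with hv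
    have hvq : (σ.coinvKer Ubar).mkQ v = (σ.coinvKer Ubar).mkQ v₀ :=
      σ.map_avg_of_forall hp _ hCM fun m hm => hq ⟨m, hm.2⟩ hm.1
    obtain ⟨S, hS, hSv⟩ := σ.smooth v
    -- The representative `v` is fixed by `K ∩ M` but perhaps not by `K ∩ U`. After translation by a
    -- high power `λʲ` it is, and averaging over `K` then preserves its class.
    obtain ⟨j, hj⟩ := hl.expands.exists_conj_subset
      (hK.isProP.1.inter_right T.isClosed_U) (hS.mem_nhds (one_mem S))
    obtain ⟨h1, h2⟩ := act_pow_fixed hl j (fun k hk => σ.act_avg_of_mem hp hCM hk v₀)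
      (fun k hk => hSv k (hj j le_rfl hk))
    have hv' : (σ.coinvKer Ubar).mkQ (σ.avg hp K hK.isProP (σ.act (l ^ j) v))
        = (σ.coinvKer Ubar).mkQ (σ.act (l ^ j) v) := by
      rw [← avg_inf_Ubar_eq hK hC h1 h2, σ.mkQ_avg hp hC inf_le_right]
    set v' := σ.avg hp K hK.isProP (σ.act (l ^ j) v) with hv'def
    obtain ⟨w, hw, hwk⟩ := hstab.exists_sub_mem_ker v'
    have hkfix : ∀ k ∈ K, σ.act k (v' - w) = v' - w := fun k hk => by
      rw [map_sub, hWfix w hw k hk, hv'def, σ.act_avg_of_mem hp hK.isProP hk]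
    -- A `K`-fixed vector killed by `τⁿ` has zero class, because `τⁿ` induces the invertible action
    -- of `λⁿ` on its class.
    have hk0 : (σ.coinvKer Ubar).mkQ (v' - w) = (σ.coinvKer Ubar).mkQ 0 := by
      refine mkQ_eq_of_mkQ_act_eq T.conj_mem_bar (pow_mem hl.mem n) ?_
      rw [← mkQ_heckeOp_pow (hp := hp) hK hC hl hkfix n, hwk, map_zero, map_zero, map_zero]
    rw [map_zero, map_sub, sub_eq_zero] at hk0
    -- `g` inverts `τ` on the image of `τⁿ`. Its iterates undo the translation by `λʲ` and then
    -- supply the sequence defining the preimage.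
    choose! g hgW hg using fun w (hw : w ∈ LinearMap.range (τ ^ n)) =>
      hstab.exists_apply_eq hn hw
    have hiter : ∀ i, ∀ u ∈ LinearMap.range (τ ^ n), g^[i] u ∈ LinearMap.range (τ ^ n) := by
      intro i u hu
      induction i with
      | zero => exact hu
      | succ i ih => rw [Function.iterate_succ_apply']; exact hgW _ ih
    have hτg : ∀ i u, u ∈ LinearMap.range (τ ^ n) → τ (g^[i + 1] u) = g^[i] u := by
      intro i u hu
      rw [Function.iterate_succ_apply', hg _ (hiter i u hu)]
    have hτpow : ∀ i, (τ ^ i) (g^[i] w) = w := by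
      intro i
      induction i with
      | zero => rfl
      | succ i ih => rw [pow_succ, Module.End.mul_apply, hτg i w hw, ih]
    set w' := g^[j] w with hw'def
    have hw' : w' ∈ LinearMap.range (τ ^ n) := hiter j w hw
    have hqw : (σ.coinvKer Ubar).mkQ v = (σ.coinvKer Ubar).mkQ w' := by
      refine mkQ_eq_of_mkQ_act_eq T.conj_mem_bar (pow_mem hl.mem j) ?_
      rw [← hv', hk0, ← mkQ_heckeOp_pow (hp := hp) hK hC hl (hWfix w' hw') j, ← hτ, hτpow]
    obtain ⟨x, hx, hxK, hx0⟩ := exists_mem_iStar_of_sequence (hp := hp) hK hC hl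
      (y := fun i => g^[i] w') (fun i => hWfix _ (hiter i w' hw')) (fun i => hτg i w' hw')
    have hxf : (⟨x, hx⟩ : σ.iStar hp U M) ∈
        fixedVectors (σ.iStarAct hp T.conj_mem) (K.subgroupOf M) := fun m hm =>
      Subtype.ext (hxK m ⟨hm, m.2⟩)
    refine ⟨⟨x, hx⟩, hxf, ?_⟩
    rw [hΦK _ hxf, ← hvq, hqw]
    exact congrArg _ hx0

/-- If for a sequence of well-placed subgroups shrinking to `1` some powers of `⟨K_e l K_e⟩` are
stable, the natural map is bijective. -/
theorem IsNaturalMap.bijective (T : IsParabolicTriple U M Ubar) {K : ℕ → Subgroup G}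
    (hK : ∀ e, IsWellPlaced p U M Ubar (K e))
    (hsmall : ∀ N ∈ nhds (1 : G), ∃ e, (K e : Set G) ⊆ N)
    (hl : ∀ e, IsStrictlyPositiveElement U M Ubar (K e) l)
    {Φ : σ.iStar hp U M →ₗ[R] σ.jacquet Ubar} (hΦ : σ.IsNaturalMap hp U M Ubar Φ)
    (hstab : ∀ e, ∃ n ≥ 1, IsStableEnd (σ.heckeOp hp (K e) (hK e).isProP l ^ n)) :
    Function.Bijective Φ := by
  have hbij : ∀ e, Set.BijOn Φ (fixedVectors (σ.iStarAct hp T.conj_mem) ((K e).subgroupOf M))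
      (fixedVectors (σ.jacquetAct T.conj_mem_bar) ((K e).subgroupOf M)) := fun e => by
    obtain ⟨n, hn, h⟩ := hstab e
    exact hΦ.bijOn_fixedVectors T (hK e) (hl e) hn h
  constructor
  · refine (injective_iff_map_eq_zero Φ).2 fun x hx0 => ?_
    -- By `M`-smoothness `x` is fixed by `K_e ∩ M` for some `e`, so injectivity on these fixed
    -- vectors suffices.
    obtain ⟨-, -, S, hS, hxS⟩ := x.2
    obtain ⟨O, hO, hOS⟩ := isOpen_induced_iff.1 hS
    have h1 : (1 : M) ∈ Subtype.val ⁻¹' O := by rw [hOS]; exact one_mem S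
    obtain ⟨e, he⟩ := hsmall O (hO.mem_nhds h1)
    have hx : x ∈ fixedVectors (σ.iStarAct hp T.conj_mem) ((K e).subgroupOf M) := fun m hm => by
      have h2 : m ∈ Subtype.val ⁻¹' O := he hm
      rw [hOS] at h2
      exact Subtype.ext (hxS m h2)
    exact (hbij e).injOn hx (zero_mem _) (by rw [hx0, map_zero])
  · intro q
    obtain ⟨v, rfl⟩ := (σ.coinvKer Ubar).mkQ_surjective q
    obtain ⟨S, hS, hSv⟩ := σ.smooth v
    obtain ⟨e, he⟩ := hsmall S (hS.mem_nhds (one_mem S))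
    obtain ⟨x, -, hx⟩ := (hbij e).surjOn (a := (σ.coinvKer Ubar).mkQ v) fun m hm => by
      change (σ.coinvKer Ubar).mkQ (σ.act m v) = _
      rw [hSv m (he hm)]
    exact ⟨x, hx⟩

end

end SmoothRep

end SecondAdjointness

/-! ### From algebraic groups over the local field to topological groups -/

section RationalPoints

variable {F : Type*} [Field F]

section

variable [TopologicalSpace F] [IsTopologicalRing F] [T1Space F]

/-- The rational points of a Zariski closed subgroup are closed in the topology of the field. -/
theorem isClosed_rationalPoints {n : ℕ}
    {H : Subgroup (Matrix.GeneralLinearGroup (Fin n) (AlgebraicClosure F))}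
    (hH : IsZariskiClosed H) :
    IsClosed (rationalPoints F H : Set (Matrix.GeneralLinearGroup (Fin n) F)) := by
  let ι : Matrix.GeneralLinearGroup (Fin n) F →*
      Matrix.GeneralLinearGroup (Fin n) (AlgebraicClosure F) :=
    Matrix.GeneralLinearGroup.map (algebraMap F (AlgebraicClosure F))
  have hι : @Continuous _ _ _ (zariskiGL n (AlgebraicClosure F)) ι := by
    refine continuous_generateFrom_iff.2 ?_
    rintro _ ⟨f, rfl⟩
    have hev : ∀ g, evalGL (ι g) f = ∑ d ∈ f.support, (∏ i ∈ d.support,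
        (g : Matrix (Fin n) (Fin n) F) i.1 i.2 ^ d i) • f.coeff d := by
      intro g
      rw [evalGL, MvPolynomial.eval_eq]
      refine Finset.sum_congr rfl fun d _ => ?_
      rw [Algebra.smul_def, mul_comm, map_prod]
      simp only [map_pow]
      rfl
    -- The coefficients lie in the algebraic closure, which carries no topology here. Applying the
    -- `F`-linear functionals `φ` turns the value into polynomials over `F` in the entries, and
    -- these functionals jointly detect non-vanishing.
    have hset : ι ⁻¹' {g | evalGL g f ≠ 0}
        = ⋃ φ : AlgebraicClosure F →ₗ[F] F, {g | φ (evalGL (ι g) f) ≠ 0} := by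
      ext g
      simp only [Set.mem_preimage, Set.mem_ofPred_eq, Set.mem_iUnion]
      constructor
      · intro h
        by_contra! h0
        exact h ((Module.forall_dual_apply_eq_zero_iff F _).1 h0)
      · rintro ⟨φ, hφ⟩ h
        exact hφ (by rw [h, map_zero])
    rw [hset]
    refine isOpen_iUnion fun φ => ?_
    refine isOpen_compl_singleton.preimage (f := fun g => φ (evalGL (ι g) f)) ?_
    simp only [hev, map_sum, map_smul, smul_eq_mul]
    have hent : ∀ i j, Continuous fun g : Matrix.GeneralLinearGroup (Fin n) F =>
        (g : Matrix (Fin n) (Fin n) F) i j := fun i j =>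
      Units.continuous_val.matrix_elem i j
    refine continuous_finsetSum _ fun d _ => Continuous.mul ?_ continuous_const
    exact continuous_finsetProd _ fun i _ => (hent _ _).pow _
  exact @IsClosed.preimage _ _ _ (zariskiGL n (AlgebraicClosure F)) _ hι _ hH

end

theorem Matrix.GeneralLinearGroup.map_injective_of_injective {n : ℕ} {A B : Type*} [CommRing A]
    [CommRing B] {f : A →+* B} (hf : Function.Injective f) :
    Function.Injective (Matrix.GeneralLinearGroup.map (n := Fin n) f) :=
  Units.map_injective (Matrix.map_injective hf)

/-- An element of `M U ∩ Ubar` lies in `P ∩ Pbar` and in `Ubar`, which meet trivially because `P ∩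
Pbar` is a Levi subgroup of `Pbar`. -/
theorem OppositeParabolics.isParabolicTriple [TopologicalSpace F] [IsTopologicalRing F]
    [T1Space F] {n : ℕ} {𝒢 : ReductiveGroup F n} (D : OppositeParabolics 𝒢) :
    IsParabolicTriple D.ptsU D.ptsM D.ptsUbar where
  isClosed_U := (isClosed_rationalPoints D.radical.1.2.2.1).preimage continuous_subtype_val
  isClosed_M := (isClosed_rationalPoints D.levi.1).preimage continuous_subtype_val
  isClosed_Ubar := (isClosed_rationalPoints D.radical_bar.1.2.2.1).preimage continuous_subtype_val
  conj_mem := D.conj_mem_ptsU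
  conj_mem_bar := D.conj_mem_ptsUbar
  inf_eq_bot := by
    intro u hu hm
    have h : Matrix.GeneralLinearGroup.map (algebraMap F (AlgebraicClosure F)) u
        ∈ (D.P ⊓ D.Pbar) ⊓ D.U := ⟨hm, hu⟩
    rw [D.levi.2.2.1, Subgroup.mem_bot] at h
    exact Subtype.ext (Matrix.GeneralLinearGroup.map_injective_of_injective
      (algebraMap F (AlgebraicClosure F)).injective (h.trans (map_one _).symm))
  mul_inf_eq_bot := by
    intro u hu m hm hmu
    have hP : ∀ g ∈ D.U, g ∈ D.P := D.radical.1.1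
    have hPbar : ∀ g ∈ D.Ubar, g ∈ D.Pbar := D.radical_bar.1.1
    have h1 : Matrix.GeneralLinearGroup.map (algebraMap F (AlgebraicClosure F)) (m * u : 𝒢.G)
        ∈ D.Ubar := hmu
    have h2 : Matrix.GeneralLinearGroup.map (algebraMap F (AlgebraicClosure F)) (m * u : 𝒢.G)
        ∈ D.P := by
      rw [Subgroup.coe_mul, map_mul]
      exact mul_mem (Subgroup.mem_inf.1 (Subgroup.mem_comap.1 (Subgroup.mem_subgroupOf.1 hm))).1
        (hP _ hu)
    have h : Matrix.GeneralLinearGroup.map (algebraMap F (AlgebraicClosure F)) (m * u : 𝒢.G)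
        ∈ (D.P ⊓ D.Pbar) ⊓ D.Ubar := ⟨⟨h2, hPbar _ h1⟩, h1⟩
    rw [D.levi_bar.2.2.1, Subgroup.mem_bot] at h
    exact Subtype.ext (Matrix.GeneralLinearGroup.map_injective_of_injective
      (algebraMap F (AlgebraicClosure F)).injective (h.trans (map_one _).symm))

theorem totallyDisconnectedSpace_GL [TopologicalSpace F] [TotallyDisconnectedSpace F] (n : ℕ) :
    TotallyDisconnectedSpace (Matrix.GeneralLinearGroup (Fin n) F) := by
  have : TotallyDisconnectedSpace (Matrix (Fin n) (Fin n) F) :=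
    inferInstanceAs (TotallyDisconnectedSpace (Fin n → Fin n → F))
  exact ⟨isTotallyDisconnected_of_image (f := Units.val) Units.continuous_val.continuousOn
    Units.val_injective (isTotallyDisconnected_of_totallyDisconnectedSpace _)⟩

/-- The balls `{v < γ}` are open additive subgroups forming a basis at `0`, and they separate
points. -/
theorem IsNonarchimedeanLocalField.totallyDisconnectedSpace [ValuativeRel F] [TopologicalSpace F]
    [IsNonarchimedeanLocalField F] : TotallyDisconnectedSpace F := by
  have : NonarchimedeanRing F :=
    { is_nonarchimedean := fun N hN => by
        obtain ⟨γ, hγ⟩ := IsValuativeTopology.mem_nhds_iff.1 hN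
        simp only [zero_add, Set.image_id'] at hγ
        have hN' : {z : F | ValuativeRel.valuation F z < γ} ∈ nhds (0 : F) :=
          IsValuativeTopology.mem_nhds_iff.2 ⟨γ, by simp⟩
        exact ⟨⟨(ValuativeRel.valuation F).ltAddSubgroup γ,
          AddSubgroup.isOpen_of_mem_nhds _ hN'⟩, hγ⟩ }
  have : T2Space F := by
    refine IsTopologicalAddGroup.t2Space_of_zero_sep fun x hx => ?_
    have hx' : ValuativeRel.valuation F x ≠ 0 := (Valuation.ne_zero_iff _).2 hx
    exact ⟨{z | ValuativeRel.valuation F z < ValuativeRel.valuation F x},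
      IsValuativeTopology.mem_nhds_iff.2 ⟨Units.mk0 _ hx', by simp⟩, by simp⟩
  infer_instance

theorem fixedVectors_twistAct {R W M : Type*} [Ring R] [AddCommGroup W] [Module R W] [Group M]
    (χ : M →* (Subring.center R)ˣ) (τ : M →* Module.End R W) {S : Subgroup M}
    (h : ∀ m ∈ S, χ m = 1) : fixedVectors (twistAct χ τ) S = fixedVectors τ S := by
  have h1 : ∀ m ∈ S, ∀ w, twistAct χ τ m w = τ m w := fun m hm w => by
    change ((χ m : Subring.center R) : R) • τ m w = τ m w
    rw [h m hm]
    exact one_smul _ _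
  ext w
  exact forall₂_congr fun m hm => by rw [h1 m hm]

end RationalPoints

/-! ### The second adjointness theorem -/

theorem mainTheorem5
    {F : Type*} [Field F] [ValuativeRel F] [TopologicalSpace F] [IsNonarchimedeanLocalField F]
    (p : ℕ) [Fact p.Prime]
    [CharP (IsLocalRing.ResidueField (Valuation.integer (ValuativeRel.valuation F))) p]
    {n : ℕ} (𝒢 : ReductiveGroup F n) (D : OppositeParabolics 𝒢)
    {R : Type*} [Ring R] (hp : IsUnit (p : R))
    {V : Type*} [AddCommGroup V] [Module R V] (σ : SmoothRep R 𝒢.G V)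
    (χ : D.ptsM →* (Subring.center R)ˣ)
    (hχ : ∀ C : Subgroup D.ptsM, IsCompact (C : Set D.ptsM) → ∀ m ∈ C, χ m = 1) :
    -- stability for one well-placed subgroup
    (∀ (l : 𝒢.G) (K : Subgroup 𝒢.G)
      (hK : IsWellPlaced p D.ptsU D.ptsM D.ptsUbar K),
      IsStrictlyPositiveElement D.ptsU D.ptsM D.ptsUbar K l →
      (∃ N : ℕ, ∀ j ≥ N, IsStableEnd (σ.heckeOp hp K hK.isProP l ^ j)) →
      ∃ Φ : σ.iStar hp D.ptsU D.ptsM →ₗ[R] σ.jacquet D.ptsUbar,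
        σ.IsNaturalMap hp D.ptsU D.ptsM D.ptsUbar Φ ∧
        (∀ Ψ, σ.IsNaturalMap hp D.ptsU D.ptsM D.ptsUbar Ψ → Ψ = Φ) ∧
        (∀ m x, Φ (twistAct χ (σ.iStarAct hp D.conj_mem_ptsU) m x) =
          twistAct χ (σ.jacquetAct D.conj_mem_ptsUbar) m (Φ x)) ∧
        Set.BijOn Φ
          (fixedVectors (twistAct χ (σ.iStarAct hp D.conj_mem_ptsU)) (K.subgroupOf D.ptsM))
          (fixedVectors (twistAct χ (σ.jacquetAct D.conj_mem_ptsUbar)) (K.subgroupOf D.ptsM))) ∧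
    -- stability for a cofinal sequence of well-placed subgroups
    (∀ (l : 𝒢.G) (K : ℕ → Subgroup 𝒢.G)
      (hK : ∀ e, IsWellPlaced p D.ptsU D.ptsM D.ptsUbar (K e)),
      (∀ N ∈ nhds (1 : 𝒢.G), ∃ e, (K e : Set 𝒢.G) ⊆ N) →
      (∀ e, IsStrictlyPositiveElement D.ptsU D.ptsM D.ptsUbar (K e) l) →
      (∀ e, ∃ N : ℕ, ∀ j ≥ N, IsStableEnd (σ.heckeOp hp (K e) (hK e).isProP l ^ j)) →
      ∃ Φ : σ.iStar hp D.ptsU D.ptsM →ₗ[R] σ.jacquet D.ptsUbar,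
        σ.IsNaturalMap hp D.ptsU D.ptsM D.ptsUbar Φ ∧
        (∀ Ψ, σ.IsNaturalMap hp D.ptsU D.ptsM D.ptsUbar Ψ → Ψ = Φ) ∧
        (∀ m x, Φ (twistAct χ (σ.iStarAct hp D.conj_mem_ptsU) m x) =
          twistAct χ (σ.jacquetAct D.conj_mem_ptsUbar) m (Φ x)) ∧
        Function.Bijective Φ) := by
  have : TotallyDisconnectedSpace F := IsNonarchimedeanLocalField.totallyDisconnectedSpace
  have : TotallyDisconnectedSpace (Matrix.GeneralLinearGroup (Fin n) F) :=
    totallyDisconnectedSpace_GL n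
  have T := D.isParabolicTriple
  have hequiv : ∀ {K : Subgroup 𝒢.G}, IsWellPlaced p D.ptsU D.ptsM D.ptsUbar K →
      ∀ {Φ : σ.iStar hp D.ptsU D.ptsM →ₗ[R] σ.jacquet D.ptsUbar},
      σ.IsNaturalMap hp D.ptsU D.ptsM D.ptsUbar Φ → ∀ m x,
      Φ (twistAct χ (σ.iStarAct hp D.conj_mem_ptsU) m x) =
        twistAct χ (σ.jacquetAct D.conj_mem_ptsUbar) m (Φ x) := by
    intro K hK Φ hΦ m x
    change Φ (((χ m : Subring.center R) : R) • σ.iStarAct hp D.conj_mem_ptsU m x)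
      = ((χ m : Subring.center R) : R) • σ.jacquetAct D.conj_mem_ptsUbar m (Φ x)
    rw [map_smul, hΦ.map_iStarAct T hK]
  refine ⟨fun l K hK hl ⟨N, hN⟩ => ?_, fun l K hK hsmall hl hstab => ?_⟩
  · obtain ⟨Φ, hΦ⟩ := SmoothRep.exists_isNaturalMap (hp := hp) (σ := σ) T hK hl
    refine ⟨Φ, hΦ, fun Ψ hΨ => hΦ.eq T hK hΨ, hequiv hK hΦ, ?_⟩
    -- `K ∩ M` is compact, so `χ` is trivial on it and the twist does not change the fixed vectors.
    have hcomp : IsCompact ((K.subgroupOf D.ptsM : Subgroup D.ptsM) : Set D.ptsM) :=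
      T.isClosed_M.isClosedEmbedding_subtypeVal.isCompact_preimage hK.isProP.1
    rw [fixedVectors_twistAct χ _ (hχ _ hcomp), fixedVectors_twistAct χ _ (hχ _ hcomp)]
    -- The exponent must be at least `1`: the zeroth power is the identity, whose stability carries
    -- no information.
    exact hΦ.bijOn_fixedVectors T hK hl (le_max_right N 1) (hN _ (le_max_left N 1))
  -- The characterisation of `Φ` does not refer to `K`, so the map built from `K_0` serves for every
  -- `K_e`.
  · obtain ⟨Φ, hΦ⟩ := SmoothRep.exists_isNaturalMap (hp := hp) (σ := σ) T (hK 0) (hl 0)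
    refine ⟨Φ, hΦ, fun Ψ hΨ => hΦ.eq T (hK 0) hΨ, hequiv (hK 0) hΦ, ?_⟩
    refine hΦ.bijective T hK hsmall hl fun e => ?_
    obtain ⟨N, hN⟩ := hstab e
    exact ⟨max N 1, le_max_right _ _, hN _ (le_max_left _ _)⟩
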